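/- Let $K$ be an arbitrary field and $\ell$ a prime number. For a (Krull) valuation $v$ of $K$ write $\mathcal O_v$ for its valuation ring and $\mathfrak m_v$ for its maximal ideal. A subgroup $H\le K^\times$ is called \emph{valuative} if $\mathcal O_v^\times\le H$ for some valuation $v$ of $K$; in that case there is a unique coarsest valuation $v_H$ of $K$ with $\mathcal O_{v_H}^\times\le H$. Let $\widehat K=\varprojlim_n K^\times/K^{\times\ell^n}$ be the $\ell$-adic completion of $K^\times$, a $\mathbb Z_\ell$-module with the inverse limit topology (each $K^\times/K^{\times\ell^n}$ being discrete). By a submodule of $\widehat K$ we always mean a closed $\mathbb Z_\ell$-submodule. For a submodule $\widehat H\le\widehat K$ let $K^\times\cap\widehat H$ denote the inverse image of $\widehat H$ under the canonical map $K^\times\to\widehat K$. We call $\widehat H$ valuative if $K^\times\cap\widehat H$ is valuative, and then put $v_{\widehat H}=v_{K^\times\cap\widehat H}$. For $x\in K^\times$, $x\in\widehat H$ means $x\in K^\times\cap\widehat H$, and similarly for subsets of $K^\times$. A subgroup $T$ with $K^{\times\ell}\le T\le K^\times$ is called \emph{rigid} if for all $x\in K^\times\smallsetminus T$ the image of $\langle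 x,1-x\rangle$ in $K^\times/T$ is cyclic. A submodule $\widehat T\le\widehat K$ is called \emph{rigid} if for all $x\in K^\times$ with $x\notin\widehat T$ the image in $\widehat K/\widehat T$ of the $\mathbb Z_\ell$-module generated by $x$ and $1-x$ is a cyclic $\mathbb Z_\ell$-module. \textbf{Theorem.} (a) Let $T$ be a subgroup of $K^\times$ with $\langle K^{\times\ell},-1\rangle\le T$. The following are equivalent: \begin{enumerate} \item There exists $H$ with $T\le H\le K^\times$ such that $H/T$ is cyclic (possibly trivial), $H$ is valuative and $1+\mathfrak m_{v_H}\le T$. \item $T$ is rigid. \end{enumerate} (b) Let $\widehat T\le\widehat K$ be a submodule such that $\widehat K/\widehat T$ is torsion-free. The following are equivalent: \begin{enumerate} \item There exists a submodule $\widehat H$ with $\widehat T\le\widehat H\le\widehat K$ such that $\widehat H/\widehat T$ is a cyclic $\mathbb Z_\ell$-module (possibly trivial), $\widehat H$ is valuative and $1+\mathfrak m_{v_{\widehat H}}\le\widehat T$. \item $\widehat T$ is rigid. \end{enumerate} -/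

import Mathlib

/-! ### Valuative and rigid subgroups of the multiplicative group of a field

Valuations are taken up to equivalence, that is, as valuation subrings `v` of `K`;
`v.unitGroup` is `O_v^×`, `v.principalUnitGroup` is `1 + m_v`, and `v ≤ w` means that
`w` is coarser than `v`. -/

/-- `H ≤ K^×` is valuative if `O_v^× ≤ H` for some valuation `v` of `K`. -/
def IsValuative {K : Type*} [Field K] (H : Subgroup Kˣ) : Prop :=
  ∃ v : ValuationSubring K, v.unitGroup ≤ H

/-- `v` is the canonical valuation `v_H` of `H`: the coarsest valuation with `O_v^× ≤ H`.
It is unique when it exists. -/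
def IsCanonicalValuation {K : Type*} [Field K] (H : Subgroup Kˣ) (v : ValuationSubring K) :
    Prop :=
  IsGreatest {w : ValuationSubring K | w.unitGroup ≤ H} v

/-- `T` is rigid: for all `x ∈ K^×` outside `T`, the image of `⟨x, 1 - x⟩` in `K^×/T` is cyclic.
Here `y` is `1 - x`, which is a unit since `x ≠ 1`. -/
def IsRigid {K : Type*} [Field K] (T : Subgroup Kˣ) : Prop :=
  ∀ x y : Kˣ, x ∉ T → (y : K) = 1 - (x : K) →
    IsCyclic ((Subgroup.closure {x, y}).map (QuotientGroup.mk' T))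

/-! ### The `ℓ`-adic completion of the multiplicative group -/

/-- The group `K^×/ℓ^n`, written additively. -/
def UnitsModPow (K : Type*) [Field K] (ℓ n : ℕ) : Type _ :=
  Additive (Kˣ ⧸ (powMonoidHom (ℓ ^ n) : Kˣ →* Kˣ).range)

namespace UnitsModPow

variable (K : Type*) [Field K] (ℓ n : ℕ)

instance : AddCommGroup (UnitsModPow K ℓ n) :=
  inferInstanceAs (AddCommGroup (Additive (Kˣ ⧸ (powMonoidHom (ℓ ^ n) : Kˣ →* Kˣ).range)))

instance : TopologicalSpace (UnitsModPow K ℓ n) := ⊥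

instance : DiscreteTopology (UnitsModPow K ℓ n) := ⟨rfl⟩

/-- The projection `K^× → K^×/ℓ^n`. -/
def mk : Additive Kˣ →+ UnitsModPow K ℓ n :=
  MonoidHom.toAdditive (QuotientGroup.mk' (powMonoidHom (ℓ ^ n) : Kˣ →* Kˣ).range)

/-- The projection `K^×/ℓ^(n+1) → K^×/ℓ^n`. -/
def transition : UnitsModPow K ℓ (n + 1) →+ UnitsModPow K ℓ n :=
  MonoidHom.toAdditive (QuotientGroup.map (powMonoidHom (ℓ ^ (n + 1)) : Kˣ →* Kˣ).range
    (powMonoidHom (ℓ ^ n) : Kˣ →* Kˣ).range (MonoidHom.id Kˣ) (by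
      rintro _ ⟨y, rfl⟩
      exact ⟨y ^ ℓ, by simp [← pow_mul, pow_succ, mul_comm]⟩))

theorem transition_mk (x : Additive Kˣ) : transition K ℓ n (mk K ℓ (n + 1) x) = mk K ℓ n x :=
  rfl

theorem mk_surjective : Function.Surjective (mk K ℓ n) :=
  QuotientGroup.mk'_surjective (powMonoidHom (ℓ ^ n) : Kˣ →* Kˣ).range

theorem pow_nsmul_eq_zero (a : UnitsModPow K ℓ n) : (ℓ ^ n) • a = 0 := by
  obtain ⟨x, rfl⟩ := mk_surjective K ℓ n a
  rw [← map_nsmul]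
  exact (QuotientGroup.eq_one_iff (N := (powMonoidHom (ℓ ^ n) : Kˣ →* Kˣ).range)
    (x.toMul ^ ℓ ^ n)).2 ⟨x.toMul, rfl⟩

instance : Module (ZMod (ℓ ^ n)) (UnitsModPow K ℓ n) :=
  AddCommGroup.zmodModule (pow_nsmul_eq_zero K ℓ n)

/-- `ℤ_ℓ` acts on `K^×/ℓ^n` through `ℤ/ℓ^n`. -/
noncomputable instance [Fact ℓ.Prime] : Module ℤ_[ℓ] (UnitsModPow K ℓ n) :=
  Module.compHom _ (PadicInt.toZModPow n : ℤ_[ℓ] →+* ZMod (ℓ ^ n))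

theorem padic_smul_eq [Fact ℓ.Prime] (z : ℤ_[ℓ]) (a : UnitsModPow K ℓ n) :
    z • a = (PadicInt.toZModPow n z).val • a := by
  change (PadicInt.toZModPow n z) • a = _
  have : NeZero (ℓ ^ n) := ⟨pow_ne_zero _ (Fact.out : ℓ.Prime).ne_zero⟩
  conv_lhs => rw [← ZMod.natCast_zmod_val (PadicInt.toZModPow n z)]
  exact Nat.cast_smul_eq_nsmul _ _ _

theorem transition_smul [Fact ℓ.Prime] (z : ℤ_[ℓ]) (a : UnitsModPow K ℓ (n + 1)) :
    transition K ℓ n (z • a) = z • transition K ℓ n a := by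
  have : NeZero (ℓ ^ n) := ⟨pow_ne_zero _ (Fact.out : ℓ.Prime).ne_zero⟩
  rw [padic_smul_eq, map_nsmul, ← Nat.cast_smul_eq_nsmul (ZMod (ℓ ^ n)), ← ZMod.cast_eq_val,
    PadicInt.cast_toZModPow n (n + 1) n.le_succ]
  rfl

end UnitsModPow

/-- The `ℓ`-adic completion `lim_n K^×/ℓ^n` of `K^×`, written additively, as a `ℤ_ℓ`-module.
It carries the inverse limit topology, the factors `K^×/ℓ^n` being discrete. -/
noncomputable def UnitsCompletion (K : Type*) [Field K] (ℓ : ℕ) [Fact ℓ.Prime] :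
    Submodule ℤ_[ℓ] (∀ n : ℕ, UnitsModPow K ℓ n) where
  carrier := {a | ∀ n, UnitsModPow.transition K ℓ n (a (n + 1)) = a n}
  add_mem' ha hb n := by simp [ha n, hb n]
  zero_mem' n := by simp
  smul_mem' z a ha n := by simp [UnitsModPow.transition_smul, ha n]

namespace UnitsCompletion

/-- The canonical map `K^× → lim_n K^×/ℓ^n`. -/
noncomputable def of (K : Type*) [Field K] (ℓ : ℕ) [Fact ℓ.Prime] :
    Additive Kˣ →+ UnitsCompletion K ℓ where
  toFun x := ⟨fun n => UnitsModPow.mk K ℓ n x, fun n => UnitsModPow.transition_mk K ℓ n x⟩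
  map_zero' := by ext n; simp
  map_add' x y := by ext n; simp

/-- `K^× ∩ T`: the inverse image in `K^×` of a submodule `T` of the completion. -/
def trace {K : Type*} [Field K] {ℓ : ℕ} [Fact ℓ.Prime]
    (T : Submodule ℤ_[ℓ] (UnitsCompletion K ℓ)) : Subgroup Kˣ where
  carrier := {x | of K ℓ (Additive.ofMul x) ∈ T}
  mul_mem' {x y} hx hy := by
    simp only [Set.mem_ofPred_eq, ofMul_mul, map_add] at *
    exact T.add_mem hx hy
  one_mem' := by simp
  inv_mem' {x} hx := by
    simp only [Set.mem_ofPred_eq, ofMul_inv, map_neg] at *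
    exact T.neg_mem hx

/-- `T` is rigid: for all `x ∈ K^×` outside `T`, the image of `⟨x, 1 - x⟩` modulo `T` is a
cyclic `ℤ_ℓ`-module. Here `y` is `1 - x`. -/
def IsRigid {K : Type*} [Field K] {ℓ : ℕ} [Fact ℓ.Prime]
    (T : Submodule ℤ_[ℓ] (UnitsCompletion K ℓ)) : Prop :=
  ∀ x y : Kˣ, x ∉ trace T → (y : K) = 1 - (x : K) →
    ((Submodule.span ℤ_[ℓ]
      {of K ℓ (Additive.ofMul x), of K ℓ (Additive.ofMul y)}).map T.mkQ).IsPrincipal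

/-- `H` is valuative if `K^× ∩ H` is. -/
def IsValuative {K : Type*} [Field K] {ℓ : ℕ} [Fact ℓ.Prime]
    (H : Submodule ℤ_[ℓ] (UnitsCompletion K ℓ)) : Prop :=
  _root_.IsValuative (trace H)

/-- `v` is the canonical valuation `v_H`, i.e. that of `K^× ∩ H`. -/
def IsCanonicalValuation {K : Type*} [Field K] {ℓ : ℕ} [Fact ℓ.Prime]
    (H : Submodule ℤ_[ℓ] (UnitsCompletion K ℓ)) (v : ValuationSubring K) : Prop :=
  _root_.IsCanonicalValuation (trace H) v

end UnitsCompletion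

/-! A valuation v with O_v^× ≤ H and 1 + m_v ≤ T controls 1 - x modulo T: its class is trivial if
v(x) > 0 and that of x if v(x) < 0 (as -1 ∈ T), while for v(x) = 0 and x ∉ T both x and 1 - x lie in
H. This gives rigidity.

Conversely, suppose that π sends 1 - x to 1 or π x for all x outside some H ⊇ ker π (`RigidPair`).
The x ∉ H with π (1 - x) = 1 have to be those of positive value (`Small`), and an element of H has
to be integral exactly when multiplication by it preserves them. This defines a valuation ring under
two multiplicative conditions (`RigidPair.IsRegular`), which are automatic if Kˣ/H has no 2-torsion.

Rigidity itself says only that φ (1 - x) is a scalar multiple of φ x ≠ 0 in a vector space: Kˣ/T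
over F_ℓ, or the localization of the completion modulo T over the fractions of ℤ_ℓ. Write the scalar
as r / (r - 1). The scalars 0 and 1 are the wanted ones; otherwise x is proper with parameter r ≠ 0,
1. For a logarithmic derivative φ the parameter would be x itself, and in general it follows x
through inverses, 1 - x and, for independent images, quotients (`IsProper.div`). Hence proper
elements with independent images have different parameters. Over F_ℓ this contradicts Fermat's
little theorem. Over ℤ_ℓ, the pigeonhole principle makes u^d v^e very close to 1 for unit parameters
u, v and small d, e, so that combinations of the two images are highly divisible; compactness turns
these into a linear relation. Thus all proper images lie on one line, whose preimage serves as H.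

For ℓ = 2 in part (a) nothing is proper, but H = ker π need not be regular, as Kˣ/H has exponent 2.
A failure of regularity produces a small element whose class, added to H, restores it
(`IsExceptional`). -/

/-! ### Valuation rings from predicates on units, and the canonical valuation -/

/-- A valuation subring given by the set of its nonzero elements. -/
def ValuationSubring.ofUnits {K : Type*} [Field K] (P : Kˣ → Prop)
    (hmul : ∀ x y, P x → P y → P (x * y)) (hneg : P (-1))
    (hsub : ∀ x y : Kˣ, P x → (y : K) = 1 - x → P y)
    (htotal : ∀ x, P x ∨ P x⁻¹) : ValuationSubring K where
  -- No unit equals 0, so 0 belongs vacuously.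
  carrier := {a | ∀ x : Kˣ, (x : K) = a → P x}
  mul_mem' {a b} ha hb x hx := by
    have ha0 : a ≠ 0 := by rintro rfl; simp at hx
    have hb0 : b ≠ 0 := by rintro rfl; simp at hx
    have : x = Units.mk0 a ha0 * Units.mk0 b hb0 := Units.ext (by simpa using hx)
    rw [this]
    exact hmul _ _ (ha _ rfl) (hb _ rfl)
  one_mem' x hx := by
    have : x = (-1) * (-1) := Units.ext (by simpa using hx)
    rw [this]
    exact hmul _ _ hneg hneg
  add_mem' {a b} ha hb x hx := by
    rcases eq_or_ne a 0 with rfl | ha0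
    · exact hb x (by simpa using hx)
    rcases eq_or_ne b 0 with rfl | hb0
    · exact ha x (by simpa using hx)
    -- a + b = a (1 - (-(b / a))); by `htotal` one of b / a and a / b satisfies P.
    have key : ∀ a b : Kˣ, P a → P (b / a) → (x : K) = a + b → P x := by
      intro a b ha hba hx
      have h1 : ((x / a : Kˣ) : K) = 1 - ((-1 * (b / a) : Kˣ) : K) := by
        push_cast
        rw [hx]
        field_simp
        simp
      have h2 := hmul _ _ ha (hsub _ _ (hmul _ _ hneg hba) h1)
      rwa [mul_div_cancel] at h2
    rcases htotal (Units.mk0 b hb0 / Units.mk0 a ha0) with h | h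
    · exact key _ _ (ha _ rfl) h hx
    · exact key _ _ (hb _ rfl) (by rwa [inv_div] at h) (by rw [hx, add_comm]; rfl)
  zero_mem' x hx := absurd hx x.ne_zero
  neg_mem' {a} ha x hx := by
    have h := hmul _ _ hneg (ha (-x) (by simp [hx]))
    simpa using h
  mem_or_inv_mem' a := by
    rcases eq_or_ne a 0 with rfl | ha0
    · exact Or.inl fun x hx => absurd hx x.ne_zero
    refine (htotal (Units.mk0 a ha0)).imp (fun h x hx => ?_) (fun h x hx => ?_)
    · rwa [show x = Units.mk0 a ha0 from Units.ext hx]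
    · rwa [show x = (Units.mk0 a ha0)⁻¹ from Units.ext (by simpa using hx)]

namespace ValuationSubring

variable {K : Type*} [Field K]

theorem coe_mem_ofUnits {P : Kˣ → Prop} {hmul hneg hsub htotal} (x : Kˣ) :
    (x : K) ∈ ValuationSubring.ofUnits P hmul hneg hsub htotal ↔ P x :=
  ⟨fun h => h x rfl, fun h y hy => by rwa [Units.ext hy]⟩

theorem mem_unitGroup_iff_mem (v : ValuationSubring K) (x : Kˣ) :
    x ∈ v.unitGroup ↔ (x : K) ∈ v ∧ ((x⁻¹ : Kˣ) : K) ∈ v := by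
  rw [mem_unitGroup_iff, ← valuation_le_one_iff, ← valuation_le_one_iff, Units.val_inv_eq_inv_val,
    map_inv₀, inv_le_one₀ (by simp [zero_lt_iff]), le_antisymm_iff]

theorem mem_principalUnitGroup_iff_inv_notMem (v : ValuationSubring K) (x y : Kˣ)
    (h : (y : K) = 1 - x) : x ∈ v.principalUnitGroup ↔ ((y⁻¹ : Kˣ) : K) ∉ v := by
  rw [mem_principalUnitGroup_iff, ← valuation_le_one_iff, Units.val_inv_eq_inv_val,
    map_inv₀, inv_le_one₀ (by simp [zero_lt_iff]), not_le, h, ← Valuation.map_neg, neg_sub]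

/-- An element outside `H` has nonnegative value for both or none of two valuations whose units
lie in `H`. -/
theorem mem_of_mem_of_unitGroup_le {H : Subgroup Kˣ} {v w : ValuationSubring K}
    (hv : v.unitGroup ≤ H) (hw : w.unitGroup ≤ H) {x : Kˣ} (hx : x ∉ H)
    (h : (x : K) ∈ v) : (x : K) ∈ w := by
  by_contra hxw
  have hxw' : ((x⁻¹ : Kˣ) : K) ∈ w := by
    simpa [hxw] using w.mem_or_inv_mem (x : K)
  have hxv' : ((x⁻¹ : Kˣ) : K) ∉ v := fun h' =>
    hx (hv ((v.mem_unitGroup_iff_mem x).2 ⟨h, h'⟩))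
  -- Now x lies in the maximal ideal of v and x⁻¹ in that of w. So 1 + x is a unit of v and (1 + x)
  -- / x = 1 + x⁻¹ a unit of w; both lie in H, hence so does their quotient x.
  have h0 : (1 : K) + x ≠ 0 := by
    intro h0
    have h1 : x = -1 := Units.ext (eq_neg_of_add_eq_zero_right h0)
    exact hxw (h1 ▸ w.neg_mem _ w.one_mem)
  have hu : Units.mk0 _ h0 ∈ v.unitGroup := by
    rw [mem_unitGroup_iff]
    rw [Units.val_mk0]
    have : v.valuation (x : K) < 1 := by
      rw [← valuation_le_one_iff, Units.val_inv_eq_inv_val,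
        map_inv₀, inv_le_one₀ (by simp [zero_lt_iff]), not_le] at hxv'
      exact hxv'
    exact Valuation.map_one_add_of_lt _ this
  have hu' : Units.mk0 _ h0 / x ∈ w.unitGroup := by
    rw [mem_unitGroup_iff]
    have h1 : ((Units.mk0 _ h0 / x : Kˣ) : K) = 1 + ((x⁻¹ : Kˣ) : K) := by
      push_cast; rw [Units.val_mk0]; field_simp; ring
    rw [h1]
    have : w.valuation ((x⁻¹ : Kˣ) : K) < 1 := by
      rw [← valuation_le_one_iff, not_le] at hxw
      rw [Units.val_inv_eq_inv_val, map_inv₀]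
      exact inv_lt_one_of_one_lt₀ hxw
    exact Valuation.map_one_add_of_lt _ this
  have := H.div_mem (hv hu) (hw hu')
  rw [div_div_cancel] at this
  exact hx this

end ValuationSubring

/-- A valuative subgroup has a canonical valuation. -/
theorem IsValuative.exists_isCanonicalValuation {K : Type*} [Field K] {H : Subgroup Kˣ}
    (h : IsValuative H) : ∃ v : ValuationSubring K, IsCanonicalValuation H v := by
  obtain ⟨v, hv⟩ := h
  -- The elements of nonnegative value outside H are the same for all valuations with units in H. P
  -- is built from this common set alone, as the largest candidate: elements of H need only preserve
  -- it under multiplication.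
  let P : Kˣ → Prop := fun x =>
    (x ∉ H → (x : K) ∈ v) ∧ (x ∈ H → ∀ y : Kˣ, y ∉ H → (y : K) ∈ v → ((x * y : Kˣ) : K) ∈ v)
  have hle : ∀ w : ValuationSubring K, w.unitGroup ≤ H → ∀ x : Kˣ, (x : K) ∈ w → P x := by
    intro w hw x hx
    refine ⟨fun hxH => ValuationSubring.mem_of_mem_of_unitGroup_le hw hv hxH hx,
      fun hxH y hy hyv => ?_⟩
    refine ValuationSubring.mem_of_mem_of_unitGroup_le hw hv ((H.mul_mem_cancel_left hxH).not.2 hy)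
      ?_
    rw [Units.val_mul]
    exact w.mul_mem _ _ hx (ValuationSubring.mem_of_mem_of_unitGroup_le hv hw hy hyv)
  have hmul : ∀ x y, P x → P y → P (x * y) := by
    intro x y hx hy
    by_cases hxH : x ∈ H <;> by_cases hyH : y ∈ H
    · refine ⟨fun h => absurd (H.mul_mem hxH hyH) h, fun _ z hz hzv => ?_⟩
      rw [mul_assoc]
      exact hx.2 hxH _ ((H.mul_mem_cancel_left hyH).not.2 hz) (hy.2 hyH z hz hzv)
    · exact ⟨fun _ => hx.2 hxH _ hyH (hy.1 hyH),
        fun h => absurd h ((H.mul_mem_cancel_left hxH).not.2 hyH)⟩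
    · exact ⟨fun _ => by rw [mul_comm]; exact hy.2 hyH _ hxH (hx.1 hxH),
        fun h => absurd h ((H.mul_mem_cancel_right hyH).not.2 hxH)⟩
    · refine hle v hv _ ?_
      rw [Units.val_mul]
      exact v.mul_mem _ _ (hx.1 hxH) (hy.1 hyH)
  have hneg : P (-1) := hle v hv _ (v.neg_mem _ v.one_mem)
  have htotal : ∀ x, P x ∨ P x⁻¹ := fun x =>
    (v.mem_or_inv_mem (x : K)).imp (hle v hv x) (fun h => hle v hv _ (by simpa using h))
  have hsub : ∀ x y : Kˣ, P x → (y : K) = 1 - x → P y := by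
    intro x y hx hy
    rcases v.mem_or_inv_mem (x : K) with h | h
    · exact hle v hv _ (by rw [hy]; exact v.sub_mem v.one_mem h)
    · have h1 : ((y * x⁻¹ : Kˣ) : K) = (x : K)⁻¹ - 1 := by
        push_cast; rw [hy]; field_simp
      have h2 := hmul _ _ hx (hle v hv (y * x⁻¹) (by rw [h1]; exact v.sub_mem h v.one_mem))
      rwa [mul_comm, inv_mul_cancel_right] at h2
  refine ⟨ValuationSubring.ofUnits P hmul hneg hsub htotal, ?_, fun w hw a ha => ?_⟩
  · intro x hx
    rw [ValuationSubring.mem_unitGroup_iff_mem, ValuationSubring.coe_mem_ofUnits,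
      ValuationSubring.coe_mem_ofUnits] at hx
    by_contra hxH
    exact hxH (hv ((v.mem_unitGroup_iff_mem x).2 ⟨hx.1.1 hxH, hx.2.1 (by simpa using hxH)⟩))
  · rcases eq_or_ne a 0 with rfl | ha0
    · exact ZeroMemClass.zero_mem _
    · exact (ValuationSubring.coe_mem_ofUnits (Units.mk0 a ha0)).2 (hle w hw _ ha)

/-- If some valuation has its units in `H` and its principal units in `T`, then so does the
canonical valuation of `H`. -/
theorem exists_isCanonicalValuation_principalUnitGroup_le {K : Type*} [Field K]
    {H T : Subgroup Kˣ} {v : ValuationSubring K} (hv : v.unitGroup ≤ H)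
    (hT : v.principalUnitGroup ≤ T) :
    ∃ w : ValuationSubring K, IsCanonicalValuation H w ∧ w.principalUnitGroup ≤ T := by
  obtain ⟨w, hw⟩ := IsValuative.exists_isCanonicalValuation ⟨v, hv⟩
  -- Coarsening shrinks the maximal ideal, hence the principal units.
  exact ⟨w, hw, (ValuationSubring.principalUnitGroup_le_principalUnitGroup.2 (hw.2 hv)).trans hT⟩

/-! ### Valuation rings from rigid pairs -/

/-- `π (1 - x)` is `1` or `π x` for all `x` outside the subgroup `H`, which contains the
kernel of `π`. -/
structure RigidPair {K : Type*} [Field K] {G : Type*} [CommGroup G] (π : Kˣ →* G)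
    (H : Subgroup Kˣ) : Prop where
  ker_le : π.ker ≤ H
  map_neg_one : π (-1) = 1
  map_one_sub : ∀ x y : Kˣ, x ∉ H → (y : K) = 1 - x → π y = 1 ∨ π y = π x

namespace RigidPair

variable {K : Type*} [Field K] {G : Type*} [CommGroup G] {π : Kˣ →* G} {H : Subgroup Kˣ}

/-- The elements outside `H` that will have positive value. -/
def Small (π : Kˣ →* G) (H : Subgroup Kˣ) (x : Kˣ) : Prop :=
  x ∉ H ∧ ∃ y : Kˣ, (y : K) = 1 - x ∧ π y = 1

/-- The units that will have nonnegative value. -/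
def Integral (π : Kˣ →* G) (H : Subgroup Kˣ) (x : Kˣ) : Prop :=
  Small π H x ∨ (x ∈ H ∧ ∀ z, Small π H z → Small π H (x * z))

/-- The pair gives rise to a valuation ring. -/
structure IsRegular (π : Kˣ →* G) (H : Subgroup Kˣ) : Prop where
  map_one_sub_mul : ∀ x y w : Kˣ, Small π H x → Small π H y → (w : K) = 1 - x * y → π w = 1
  small_mul_mul : ∀ x y z : Kˣ, Small π H x → Small π H y → Small π H z → x * y ∈ H →
    Small π H (x * y * z)

theorem Small.map_one_sub {x w : Kˣ} (h : Small π H x) (hw : (w : K) = 1 - x) : π w = 1 := by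
  obtain ⟨y, hy, hπ⟩ := h.2
  rwa [show w = y from Units.ext (hw.trans hy.symm)]

theorem map_neg (h : RigidPair π H) (x : Kˣ) : π (-x) = π x := by
  rw [← neg_one_mul, map_mul, h.map_neg_one, one_mul]

theorem neg_mem_iff (h : RigidPair π H) (x : Kˣ) : -x ∈ H ↔ x ∈ H := by
  rw [← neg_one_mul]
  exact H.mul_mem_cancel_left (h.ker_le h.map_neg_one)

theorem mem_iff_of_map_eq (h : RigidPair π H) {x y : Kˣ} (hxy : π x = π y) : x ∈ H ↔ y ∈ H := by
  have h1 : x / y ∈ H := h.ker_le (by rw [MonoidHom.mem_ker, map_div, hxy, div_self'])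
  constructor
  · intro hx
    simpa using H.div_mem hx h1
  · intro hy
    simpa using H.mul_mem h1 hy

theorem map_ne (h : RigidPair π H) {x y : Kˣ} (hx : x ∈ H) (hy : y ∉ H) : π y ≠ π x :=
  fun hxy => hy ((h.mem_iff_of_map_eq hxy).2 hx)

theorem map_ne_one (h : RigidPair π H) {y : Kˣ} (hy : y ∉ H) : π y ≠ 1 :=
  fun hxy => hy (h.ker_le hxy)

theorem exists_one_sub {x : Kˣ} (hx : x ∉ H) : ∃ y : Kˣ, (y : K) = 1 - x := by
  refine ⟨Units.mk0 (1 - x) fun h0 => hx ?_, rfl⟩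
  rw [show x = 1 from Units.ext (by simpa using (sub_eq_zero.1 h0).symm)]
  exact H.one_mem

/-- The class of a difference of two elements that differ modulo `H`. -/
theorem map_sub (h : RigidPair π H) {u v w : Kˣ} (hw : (w : K) = u - v) (huv : v / u ∉ H) :
    π w = π u ∨ π w = π v := by
  have h1 : ((w / u : Kˣ) : K) = 1 - ((v / u : Kˣ) : K) := by
    push_cast
    rw [hw]
    field_simp
  refine (h.map_one_sub _ _ huv h1).imp (fun h2 => ?_) (fun h2 => ?_)
  · rwa [map_div, div_eq_one] at h2
  · rwa [map_div, map_div, div_left_inj] at h2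

theorem map_add (h : RigidPair π H) {u v w : Kˣ} (hw : (w : K) = u + v) (huv : v / u ∉ H) :
    π w = π u ∨ π w = π v := by
  have := h.map_sub (u := u) (v := -v) (w := w) (by rw [hw]; push_cast; ring)
    (by rwa [neg_div, h.neg_mem_iff])
  rwa [h.map_neg] at this

/-- Since 1 - x⁻¹ = -(1 - x) / x, the alternatives π (1 - x) = 1 and π (1 - x) = π x are exchanged
by inversion. -/
theorem small_or_small_inv (h : RigidPair π H) {x : Kˣ} (hx : x ∉ H) :
    Small π H x ∨ Small π H x⁻¹ := by
  obtain ⟨y, hy⟩ := exists_one_sub hx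
  refine (h.map_one_sub x y hx hy).imp (fun h1 => ⟨hx, y, hy, h1⟩)
    (fun h1 => ⟨by simpa using hx, -(y / x), ?_, ?_⟩)
  · push_cast
    rw [hy]
    field_simp
    ring
  · rw [h.map_neg, map_div, h1, div_self']

theorem Small.not_inv (h : RigidPair π H) {x : Kˣ} (hx : Small π H x) : ¬ Small π H x⁻¹ := by
  rintro ⟨-, z, hz, hz1⟩
  obtain ⟨hxH, y, hy, hy1⟩ := hx
  have : z = -(y / x) := Units.ext (by
    push_cast at hz ⊢
    rw [hz, hy]
    field_simp
    ring)
  rw [this, h.map_neg, map_div, hy1, one_div, inv_eq_one] at hz1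
  exact hxH (h.ker_le hz1)

theorem small_of_map_ne (h : RigidPair π H) {x w : Kˣ} (hx : x ∉ H) (hw : (w : K) = 1 - x)
    (hne : π w ≠ π x) : Small π H x :=
  ⟨hx, w, hw, (h.map_one_sub x w hx hw).resolve_right hne⟩

/-- `1 - x y` for small `x` and `y`. -/
theorem map_one_sub_mul (h : RigidPair π H) {x y w : Kˣ} (hx : Small π H x) (hy : Small π H y)
    (hw : (w : K) = 1 - x * y) : π w = 1 ∨ (π w = π x ∧ π w = π y) := by
  have key : ∀ x y : Kˣ, Small π H x → Small π H y → (w : K) = 1 - x * y →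
      π w = 1 ∨ π w = π x := by
    intro x y hx hy hw
    obtain ⟨hxH, a, ha, ha1⟩ := hx
    obtain ⟨hyH, b, hb, hb1⟩ := hy
    -- 1 - x y = (1 - x) + x (1 - y), whose summands have classes 1 and π x.
    have h1 := h.map_add (u := a) (v := x * b) (w := w) (by push_cast; rw [hw, ha, hb]; ring)
      fun h2 => hxH ((h.mem_iff_of_map_eq (by
        rw [map_div, map_mul, ha1, hb1, div_one, mul_one])).1 h2)
    rwa [map_mul, ha1, hb1, mul_one] at h1
  rcases key x y hx hy hw with h1 | h1
  · exact Or.inl h1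
  · exact (key y x hy hx (by rw [hw, mul_comm])).imp id fun h2 => ⟨h1, h2⟩

/-- The class of 1 - x y is 1 or π x, and both differ from π (x y), because x y and y are outside H.
-/
theorem Small.mul (h : RigidPair π H) {x y : Kˣ} (hx : Small π H x) (hy : Small π H y)
    (hxy : x * y ∉ H) : Small π H (x * y) := by
  obtain ⟨w, hw⟩ := exists_one_sub hxy
  refine h.small_of_map_ne hxy hw fun h1 => ?_
  rcases h.map_one_sub_mul hx hy (by simpa using hw) with h2 | ⟨h2, -⟩
  · exact h.map_ne_one hxy (h1.symm.trans h2)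
  · rw [h2, map_mul, left_eq_mul] at h1
    exact hy.1 (h.ker_le h1)

/-- Regularity makes the class of (1 - x) (1 + x) = 1 - x² trivial, and that of 1 - x already is. -/
theorem Small.neg (h : RigidPair π H) (hr : IsRegular π H) {x : Kˣ} (hx : Small π H x) :
    Small π H (-x) := by
  obtain ⟨w, hw⟩ := exists_one_sub ((h.neg_mem_iff x).not.2 hx.1)
  refine h.small_of_map_ne ((h.neg_mem_iff x).not.2 hx.1) hw fun h1 => ?_
  obtain ⟨hxH, y, hy, hy1⟩ := hx
  have h2 := hr.map_one_sub_mul x x (y * w) ⟨hxH, y, hy, hy1⟩ ⟨hxH, y, hy, hy1⟩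
    (by push_cast at hw ⊢; rw [hw, hy]; ring)
  rw [map_mul, hy1, one_mul, h1, h.map_neg] at h2
  exact h.map_ne_one hxH h2

theorem integral_neg_one (h : RigidPair π H) (hr : IsRegular π H) : Integral π H (-1) :=
  Or.inr ⟨h.ker_le h.map_neg_one, fun z hz => by simpa using hz.neg h hr⟩

theorem Small.integral_mul (h : RigidPair π H) (hr : IsRegular π H) {x y : Kˣ}
    (hx : Small π H x) (hy : Small π H y) : Integral π H (x * y) := by
  by_cases hxy : x * y ∈ H
  · exact Or.inr ⟨hxy, fun z hz => hr.small_mul_mul x y z hx hy hz hxy⟩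
  · exact Or.inl (hx.mul h hy hxy)

theorem Integral.mul (h : RigidPair π H) (hr : IsRegular π H) {x y : Kˣ}
    (hx : Integral π H x) (hy : Integral π H y) : Integral π H (x * y) := by
  rcases hx with hx | ⟨hx, hx'⟩ <;> rcases hy with hy | ⟨hy, hy'⟩
  · exact hx.integral_mul h hr hy
  · exact Or.inl (by rw [mul_comm]; exact hy' x hx)
  · exact Or.inl (hx' y hy)
  · exact Or.inr ⟨H.mul_mem hx hy, fun z hz => by rw [mul_assoc]; exact hx' _ (hy' z hz)⟩

/-- If a small `z` times `w` is not small, then `w⁻¹` is a product of two small elements. -/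
theorem exists_small_mul_eq_inv (h : RigidPair π H) {w z : Kˣ} (hw : w ∈ H) (hz : Small π H z)
    (hwz : ¬ Small π H (w * z)) : ∃ s, Small π H s ∧ s * z = w⁻¹ := by
  refine ⟨(w * z)⁻¹, (h.small_or_small_inv fun h1 => hz.1 ?_).resolve_left hwz,
    by rw [mul_inv_rev, mul_comm, mul_inv_cancel_left]⟩
  exact (H.mul_mem_cancel_left hw).1 h1

/-- If x ∈ H moves some small element out of the small ones, then x⁻¹ is a product of two small
elements, and such products are integral. -/
theorem integral_or_integral_inv (h : RigidPair π H) (hr : IsRegular π H) (x : Kˣ) :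
    Integral π H x ∨ Integral π H x⁻¹ := by
  by_cases hx : x ∈ H
  · by_contra! hcon
    obtain ⟨h1, h2⟩ := hcon
    have h1' : ∃ y, Small π H y ∧ ¬ Small π H (x * y) := by
      by_contra! h3
      exact h1 (Or.inr ⟨hx, h3⟩)
    obtain ⟨y, hy, hxy⟩ := h1'
    obtain ⟨s, hs, hsy⟩ := h.exists_small_mul_eq_inv hx hy hxy
    exact h2 (hsy ▸ hs.integral_mul h hr hy)
  · exact (h.small_or_small_inv hx).imp Or.inl Or.inl

/-- For small `x`, the element `1 - x` and its inverse preserve small elements. -/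
theorem Small.one_sub_mul (h : RigidPair π H) (hr : IsRegular π H) {x y z : Kˣ}
    (hx : Small π H x) (hy : (y : K) = 1 - x) (hz : Small π H z) :
    Small π H (y * z) ∧ Small π H (y⁻¹ * z) := by
  have hy1 := hx.map_one_sub hy
  have hyH : y ∈ H := h.ker_le hy1
  constructor
  · by_contra hcon
    obtain ⟨s, hs, hsz⟩ := h.exists_small_mul_eq_inv hyH hz hcon
    -- s z = (1 - x)⁻¹ gives 1 - s z = -x / (1 - x), of class π x ≠ 1, against regularity.
    have h1 := hr.map_one_sub_mul s z (-(x / y)) hs hz (by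
      rw [← Units.val_mul, hsz]
      push_cast
      field_simp
      rw [hy]
      ring)
    rw [h.map_neg, map_div, hy1, div_one] at h1
    exact hx.1 (h.ker_le h1)
  · by_contra hcon
    obtain ⟨s, hs, hsz⟩ := h.exists_small_mul_eq_inv (H.inv_mem hyH) hz hcon
    have h1 := hr.map_one_sub_mul s z x hs hz (by
      rw [← Units.val_mul, hsz, inv_inv, hy]
      ring)
    exact hx.1 (h.ker_le h1)

theorem Integral.one_sub (h : RigidPair π H) (hr : IsRegular π H) {x y : Kˣ}
    (hx : Integral π H x) (hy : (y : K) = 1 - x) : Integral π H y := by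
  rcases hx with hx | ⟨hxH, hx⟩
  · exact Or.inr ⟨h.ker_le (hx.map_one_sub hy), fun z hz => (hx.one_sub_mul h hr hy hz).1⟩
  by_cases hyH : y ∈ H
  · refine Or.inr ⟨hyH, fun z hz => ?_⟩
    obtain ⟨t, ht⟩ := exists_one_sub hz.1
    -- With t = 1 - z, one has 1 - (1 - x) z = t (1 + t⁻¹ x z); both factors turn out to have
    -- trivial class.
    have hp : Small π H (-(t⁻¹ * (x * z))) := ((hz.one_sub_mul h hr ht (hx z hz)).2).neg h hr
    obtain ⟨q, hq⟩ := exists_one_sub hp.1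
    have hyz : y * z ∉ H := (H.mul_mem_cancel_left hyH).not.2 hz.1
    refine ⟨hyz, t * q, ?_, ?_⟩
    · push_cast at hq ⊢
      rw [hq, hy]
      field_simp
      rw [ht]
      ring
    · rw [map_mul, hz.map_one_sub ht, hp.map_one_sub hq, one_mul]
  · left
    have h1 : (x : K) = 1 - y := by rw [hy]; ring
    exact h.small_of_map_ne hyH h1 fun h2 => h.map_ne hxH hyH h2.symm

/-- A regular rigid pair comes from a valuation. -/
theorem exists_valuationSubring (h : RigidPair π H) (hr : IsRegular π H) :
    ∃ v : ValuationSubring K, v.unitGroup ≤ H ∧ v.principalUnitGroup ≤ π.ker := by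
  refine ⟨ValuationSubring.ofUnits (Integral π H) (fun x y hx hy => hx.mul h hr hy)
    (h.integral_neg_one hr) (fun x y hx hy => hx.one_sub h hr hy)
    (h.integral_or_integral_inv hr), fun x hx => ?_, fun y hy => ?_⟩
  · rw [ValuationSubring.mem_unitGroup_iff_mem, ValuationSubring.coe_mem_ofUnits,
      ValuationSubring.coe_mem_ofUnits] at hx
    by_contra hxH
    have h1 := hx.1.resolve_right fun h1 => hxH h1.1
    exact h1.not_inv h (hx.2.resolve_right fun h2 => hxH (by simpa using h2.1))
  · by_cases h0 : y = 1
    · rw [h0]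
      exact Subgroup.one_mem _
    obtain ⟨x, hx⟩ : ∃ x : Kˣ, (x : K) = 1 - y :=
      ⟨Units.mk0 (1 - y) fun h1 => h0 (Units.ext (by simpa using (sub_eq_zero.1 h1).symm)), rfl⟩
    rw [ValuationSubring.mem_principalUnitGroup_iff_inv_notMem _ y x hx,
      ValuationSubring.coe_mem_ofUnits] at hy
    have hy' : (y : K) = 1 - x := by rw [hx]; ring
    rw [MonoidHom.mem_ker]
    by_cases hxH : x ∈ H
    -- x⁻¹ is not integral, so x is a product of two small elements and regularity applies to y = 1
    -- - x.
    · have h2 : ∃ z, Small π H z ∧ ¬ Small π H (x⁻¹ * z) := by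
        by_contra! h3
        exact hy (Or.inr ⟨H.inv_mem hxH, h3⟩)
      obtain ⟨z, hz, hxz⟩ := h2
      obtain ⟨s, hs, hsz⟩ := h.exists_small_mul_eq_inv (H.inv_mem hxH) hz hxz
      refine hr.map_one_sub_mul s z y hs hz ?_
      rw [← Units.val_mul, hsz, inv_inv, hy']
    · exact ((h.small_or_small_inv hxH).resolve_right fun h1 => hy (Or.inl h1)).map_one_sub hy'

/-- Regularity is automatic if `Kˣ ⧸ H` has no `2`-torsion. -/
theorem isRegular_of_sq_mem (h : RigidPair π H) (hH : ∀ x : Kˣ, x ^ 2 ∈ H → x ∈ H) :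
    IsRegular π H where
  map_one_sub_mul x y w hx hy hw := by
    by_contra hcon
    obtain ⟨h1, h2⟩ := (h.map_one_sub_mul hx hy hw).resolve_left hcon
    have hxy : x * y ∉ H := fun h3 => hx.1 (hH x ((h.mem_iff_of_map_eq (by
      rw [map_mul, map_pow, sq, ← h2, h1])).1 h3))
    exact hcon ((hx.mul h hy hxy).map_one_sub (by simpa using hw))
  small_mul_mul x y z hx hy hz hxy := by
    -- As x² = (x y) (x z) / (y z), not all three products lie in H. One of y z and x z is thus
    -- outside H, and multiplying these two factors first never meets H.
    by_cases hyz : y * z ∈ H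
    · by_cases hxz : x * z ∈ H
      · refine absurd (hH x ?_) hx.1
        have h1 : x ^ 2 = x * y * (x * z) / (y * z) := by
          rw [eq_div_iff_mul_eq', sq, mul_mul_mul_comm]
        rw [h1]
        exact H.div_mem (H.mul_mem hxy hxz) hyz
      · rw [mul_right_comm]
        exact (hx.mul h hz hxz).mul h hy (by
          rw [mul_right_comm]; exact (H.mul_mem_cancel_left hxy).not.2 hz.1)
    · rw [mul_assoc]
      exact hx.mul h (hy.mul h hz hyz) (by
        rw [← mul_assoc]; exact (H.mul_mem_cancel_left hxy).not.2 hz.1)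

end RigidPair

namespace RigidPair

variable {K : Type*} [Field K] {G : Type*} [CommGroup G] {π : Kˣ →* G}

/-! ### Exponent two -/

/-- A small element below which there are only small elements of the same class. -/
def IsExceptional (π : Kˣ →* G) (x : Kˣ) : Prop :=
  Small π π.ker x ∧ ∀ w, Small π π.ker w → π w ≠ π x → Small π π.ker (w / x)

/-- The hypotheses force π w = π x = π y. If x / v were small for a small v of another class, then y
v would be small too, and x y = (x / v) (y v) would also force π w = π (x / v), that is π v = 1. -/
theorem isExceptional_of_map_one_sub_mul (h : RigidPair π π.ker) (h2 : ∀ g : G, g * g = 1)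
    {x y w : Kˣ} (hx : Small π π.ker x) (hy : Small π π.ker y) (hw : (w : K) = 1 - x * y)
    (hπ : π w ≠ 1) : IsExceptional π x := by
  refine ⟨hx, fun v hv hvx => ?_⟩
  obtain ⟨h3, h4⟩ := (h.map_one_sub_mul hx hy hw).resolve_left hπ
  have hvx' : v / x ∉ π.ker := by rwa [MonoidHom.mem_ker, map_div, div_eq_one]
  refine (h.small_or_small_inv hvx').resolve_right fun hcon => ?_
  rw [inv_div] at hcon
  have hyv : Small π π.ker (y * v) := hy.mul h hv fun h5 => hvx (by
    rw [MonoidHom.mem_ker, map_mul, ← h4, h3] at h5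
    rw [← inv_eq_of_mul_eq_one_right h5]
    exact inv_eq_of_mul_eq_one_right (h2 _))
  rcases h.map_one_sub_mul hcon hyv (w := w) (by rw [hw]; push_cast; field_simp) with h5 | ⟨h5, -⟩
  · exact hπ h5
  · rw [h3, map_div, eq_comm, div_eq_self] at h5
    exact hv.1 h5

/-- Each regularity condition fails only next to an exceptional element. For the first this is the
preceding lemma. If x y z is not small although x y ∈ ker π, then x, y, z have the same class, and z
is exceptional: were z / v small for a small v of another class, one could multiply z / v
successively by y, x, v without meeting ker π and find x y z small. -/
theorem exists_isExceptional (h : RigidPair π π.ker) (h2 : ∀ g : G, g * g = 1)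
    (hr : ¬ IsRegular π π.ker) : ∃ x, IsExceptional π x := by
  have hinv : ∀ g k : G, g * k = 1 → g = k := fun g k hgk => by
    rw [← inv_eq_of_mul_eq_one_right (h2 g), inv_eq_of_mul_eq_one_right hgk]
  by_contra! hcon
  refine hr ⟨fun x y w hx hy hw => ?_, fun x y z hx hy hz hxy => ?_⟩
  · by_contra hπ
    exact hcon x (h.isExceptional_of_map_one_sub_mul h2 hx hy hw hπ)
  · by_contra hxyz
    rw [MonoidHom.mem_ker, map_mul] at hxy
    have hyx : π y = π x := (hinv _ _ hxy).symm
    have hyz : π z = π y := by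
      by_contra hzy
      refine hxyz ?_
      rw [mul_assoc]
      refine hx.mul h (hy.mul h hz fun h3 => hzy ?_) fun h3 => hz.1 ?_
      · rw [MonoidHom.mem_ker, map_mul] at h3
        exact (hinv _ _ h3).symm
      · rwa [MonoidHom.mem_ker, map_mul, map_mul, ← mul_assoc, hxy, one_mul] at h3
    refine hcon z ⟨hz, fun v hv hvz => ?_⟩
    have hvz' : v / z ∉ π.ker := by rwa [MonoidHom.mem_ker, map_div, div_eq_one]
    refine (h.small_or_small_inv hvz').resolve_right fun hzv => hxyz ?_
    rw [inv_div] at hzv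
    have e1 : Small π π.ker (y * (z / v)) := hy.mul h hzv (by
      rw [MonoidHom.mem_ker, map_mul, map_div, ← mul_div_assoc, hyz, h2, one_div, inv_eq_one]
      exact hv.1)
    have e2 : Small π π.ker (x * (y * (z / v))) := hx.mul h e1 (by
      rw [MonoidHom.mem_ker, map_mul, map_mul, map_div, ← mul_assoc, hxy, one_mul, div_eq_one]
      exact hvz.symm)
    have e3 := e2.mul h hv (by
      rw [MonoidHom.mem_ker, map_mul, map_mul, map_mul, map_div, ← mul_assoc, hxy, one_mul,
        div_mul_cancel]
      exact hz.1)
    rwa [mul_assoc, mul_assoc, div_mul_cancel, ← mul_assoc] at e3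

/-- Outside the enlarged H, multiplication and division by e preserve small elements. If π (1 - x y)
≠ 1 there, then x is exceptional as well, so that x / e and e / x are both small, which is absurd. A
product y z ∈ ker π is avoided by replacing z with z / e and restoring e at the end. -/
theorem exists_isRegular_of_isExceptional (h : RigidPair π π.ker) (h2 : ∀ g : G, g * g = 1)
    {e : Kˣ} (he : IsExceptional π e) :
    RigidPair π ((Subgroup.zpowers (π e)).comap π) ∧
      IsRegular π ((Subgroup.zpowers (π e)).comap π) := by
  have hinv : ∀ g k : G, g * k = 1 → g = k := fun g k hgk => by
    rw [← inv_eq_of_mul_eq_one_right (h2 g), inv_eq_of_mul_eq_one_right hgk]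
  set H := (Subgroup.zpowers (π e)).comap π with hH
  have hle : π.ker ≤ H := fun x hx => by
    rw [hH, Subgroup.mem_comap, MonoidHom.mem_ker.1 hx]
    exact Subgroup.one_mem _
  have hrp : RigidPair π H :=
    ⟨hle, h.map_neg_one, fun x y hx hy => h.map_one_sub x y (fun h3 => hx (hle h3)) hy⟩
  have heH : e ∈ H := Subgroup.mem_zpowers (π e)
  have hS : ∀ w, w ∉ H → Small π π.ker w → Small π H w := fun w hw h3 => ⟨hw, h3.2⟩
  have hS' : ∀ w, Small π H w → Small π π.ker w := fun w hw => ⟨fun h3 => hw.1 (hle h3), hw.2⟩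
  have hne : ∀ w, w ∉ H → π w ≠ π e := fun w hw => hrp.map_ne heH hw
  have hdiv : ∀ w, Small π H w → Small π H (w / e) := fun w hw =>
    hS _ (fun h3 => hw.1 (by simpa using H.mul_mem h3 heH)) (he.2 w (hS' w hw) (hne w hw.1))
  have hmul : ∀ w, Small π H w → Small π H (w * e) := fun w hw =>
    have h3 : w * e ∉ H := (H.mul_mem_cancel_right heH).not.2 hw.1
    hS _ h3 ((hS' w hw).mul h he.1 fun h4 => h3 (hle h4))
  refine ⟨hrp, fun x y w hx hy hw => ?_, fun x y z hx hy hz hxy => ?_⟩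
  · by_contra hπ
    have h3 := (h.isExceptional_of_map_one_sub_mul h2 (hS' x hx) (hS' y hy) hw hπ).2 e he.1
      (hne x hx.1).symm
    exact h3.not_inv h (by rw [inv_div]; exact hS' _ (hdiv x hx))
  · have hxyz : x * y * z ∉ H := (H.mul_mem_cancel_left hxy).not.2 hz.1
    rw [mul_assoc] at hxyz ⊢
    by_cases hyz : y * z ∈ π.ker
    · have e1 : Small π π.ker (y * (z / e)) := (hS' y hy).mul h (hS' _ (hdiv z hz)) fun h3 =>
        he.1.1 (by
          rw [← mul_div_assoc, MonoidHom.mem_ker, map_div, hyz, one_div, inv_eq_one] at h3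
          exact h3)
      have h4 : x * (y * (z / e)) ∉ H := fun h3 => hxyz (by
        have h5 := H.mul_mem h3 heH
        rwa [mul_assoc, mul_assoc, div_mul_cancel] at h5)
      have e2 := hmul _ (hS _ h4 ((hS' x hx).mul h e1 fun h3 => h4 (hle h3)))
      rwa [mul_assoc, mul_assoc, div_mul_cancel] at e2
    · exact hS _ hxyz ((hS' x hx).mul h ((hS' y hy).mul h (hS' z hz) hyz) fun h3 => hxyz (hle h3))

/-- In exponent two, a rigid kernel has an enlargement of index at most two that comes from a
valuation. -/
theorem exists_comap_zpowers_of_exponent_two (h : RigidPair π π.ker) (h2 : ∀ g : G, g * g = 1) :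
    ∃ (e : Kˣ) (v : ValuationSubring K),
      v.unitGroup ≤ (Subgroup.zpowers (π e)).comap π ∧ v.principalUnitGroup ≤ π.ker := by
  by_cases hr : IsRegular π π.ker
  · obtain ⟨v, hv, hv'⟩ := h.exists_valuationSubring hr
    refine ⟨1, v, hv.trans fun x hx => ?_, hv'⟩
    rw [Subgroup.mem_comap, MonoidHom.mem_ker.1 hx]
    exact Subgroup.one_mem _
  · obtain ⟨e, he⟩ := h.exists_isExceptional h2 hr
    obtain ⟨h3, h4⟩ := h.exists_isRegular_of_isExceptional h2 he
    obtain ⟨v, hv, hv'⟩ := h3.exists_valuationSubring h4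
    exact ⟨e, v, hv, hv'⟩

end RigidPair

/-! ### Collinear maps to vector spaces -/

/-- A homomorphism from `Kˣ` to a vector space such that the image of `1 - x` is a multiple of
that of `x` whenever the latter does not vanish. -/
structure IsCollinearMap {K : Type*} [Field K] (k : Type*) [Field k] {V : Type*} [AddCommGroup V]
    [Module k V] (φ : Additive Kˣ →+ V) : Prop where
  map_neg_one : φ (Additive.ofMul (-1)) = 0
  map_one_sub : ∀ x y : Kˣ, φ (Additive.ofMul x) ≠ 0 → (y : K) = 1 - x →
    ∃ a : k, φ (Additive.ofMul y) = a • φ (Additive.ofMul x)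

namespace IsCollinearMap

open Additive

variable {K : Type*} [Field K] {k : Type*} [Field k] {V : Type*} [AddCommGroup V] [Module k V]
  {φ : Additive Kˣ →+ V}

/-- The image of `1 - x` is `r / (r - 1)` times that of `x`, with `r ≠ 0, 1`. -/
def IsProper (φ : Additive Kˣ →+ V) (x : Kˣ) (r : k) : Prop :=
  φ (ofMul x) ≠ 0 ∧ r ≠ 0 ∧ r ≠ 1 ∧
    ∃ y : Kˣ, (y : K) = 1 - x ∧ (r - 1) • φ (ofMul y) = r • φ (ofMul x)

theorem map_ofMul_neg (h : IsCollinearMap k φ) (x : Kˣ) : φ (ofMul (-x)) = φ (ofMul x) := by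
  rw [← neg_one_mul, ofMul_mul, map_add, h.map_neg_one, zero_add]

theorem exists_one_sub {x : Kˣ} (hx : φ (ofMul x) ≠ 0) : ∃ y : Kˣ, (y : K) = 1 - x := by
  refine ⟨Units.mk0 (1 - x) fun h0 => hx ?_, rfl⟩
  rw [show x = 1 from Units.ext (by simpa using (sub_eq_zero.1 h0).symm), ofMul_one, map_zero]

theorem map_one_sub_eq_or (h : IsCollinearMap k φ) {x y : Kˣ} (hx : φ (ofMul x) ≠ 0)
    (hy : (y : K) = 1 - x) : φ (ofMul y) = 0 ∨ φ (ofMul y) = φ (ofMul x) ∨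
      ∃ r : k, IsProper φ x r := by
  obtain ⟨a, ha⟩ := h.map_one_sub x y hx hy
  rcases eq_or_ne a 0 with rfl | ha0
  · exact Or.inl (by rw [ha, zero_smul])
  rcases eq_or_ne a 1 with rfl | ha1
  · exact Or.inr (Or.inl (by rw [ha, one_smul]))
  have h1 : a - 1 ≠ 0 := sub_ne_zero.2 ha1
  -- The map a ↦ a / (a - 1) is its own inverse.
  refine Or.inr (Or.inr ⟨a / (a - 1), hx, div_ne_zero ha0 h1, fun h2 => ?_, y, hy, ?_⟩)
  · rw [div_eq_one_iff_eq h1] at h2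
    exact one_ne_zero (sub_eq_self.1 h2.symm)
  · rw [ha, smul_smul]
    congr 1
    field_simp
    ring

theorem IsProper.inv (h : IsCollinearMap k φ) {x : Kˣ} {r : k} (hx : IsProper φ x r) :
    IsProper φ x⁻¹ r⁻¹ := by
  obtain ⟨hx0, hr0, hr1, y, hy, hr⟩ := hx
  refine ⟨by simpa using hx0, inv_ne_zero hr0, by simpa using hr1, -(y / x), ?_, ?_⟩
  · push_cast
    rw [hy]
    field_simp
    ring
  · rw [h.map_ofMul_neg, ofMul_div, map_sub, ofMul_inv, map_neg]
    have h1 : (r⁻¹ - 1) = -(r⁻¹ * (r - 1)) := by field_simp; ring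
    rw [smul_sub, h1, neg_smul, mul_smul, hr, ← h1, smul_smul, inv_mul_cancel₀ hr0]
    module

theorem IsProper.one_sub {x y : Kˣ} {r : k} (hx : IsProper φ x r) (hy : (y : K) = 1 - x) :
    IsProper φ y (1 - r) := by
  obtain ⟨hx0, hr0, hr1, y', hy', hr⟩ := hx
  obtain rfl : y' = y := Units.ext (hy'.trans hy.symm)
  refine ⟨fun h0 => ?_, sub_ne_zero.2 hr1.symm, by simpa using hr0, x, by rw [hy]; ring, ?_⟩
  · rw [h0, smul_zero] at hr
    exact (smul_ne_zero hr0 hx0) hr.symm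
  · have : (1 - r) • φ (ofMul y') = -((r - 1) • φ (ofMul y')) := by module
    rw [this, hr]
    module

/-- With u = 1 - x and v = 1 - y, the difference x - y is both x (1 - y / x) and -u (1 - v / u).
Collinearity expresses the image of each side in φ x and φ y; comparing coefficients gives φ (1 - y
/ x) = c • φ (y / x) with c = s / (s - r). So y / x has parameter s / r. -/
theorem IsProper.div (h : IsCollinearMap k φ) {x y : Kˣ} {r s : k} (hx : IsProper φ x r)
    (hy : IsProper φ y s) (hxy : LinearIndependent k ![φ (ofMul x), φ (ofMul y)]) :
    IsProper φ (x / y) (r / s) := by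
  rw [LinearIndependent.pair_iff] at hxy
  obtain ⟨hx0, hr0, hr1, u, hu, hr⟩ := hx
  obtain ⟨hy0, hs0, hs1, v, hv, hs⟩ := hy
  have hr1' := sub_ne_zero.2 hr1
  have hs1' := sub_ne_zero.2 hs1
  have hu' : φ (ofMul u) = (r / (r - 1)) • φ (ofMul x) := by
    rw [div_eq_inv_mul, mul_smul, ← hr, smul_smul, inv_mul_cancel₀ hr1', one_smul]
  have hv' : φ (ofMul v) = (s / (s - 1)) • φ (ofMul y) := by
    rw [div_eq_inv_mul, mul_smul, ← hs, smul_smul, inv_mul_cancel₀ hs1', one_smul]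
  have h1 : φ (ofMul (y / x)) ≠ 0 := fun h0 => by
    rw [ofMul_div, map_sub] at h0
    have := hxy (-1) 1 (by rw [← h0]; module)
    exact one_ne_zero this.2
  have h2 : φ (ofMul (v / u)) ≠ 0 := fun h0 => by
    rw [ofMul_div, map_sub, hu', hv'] at h0
    have := hxy (-(r / (r - 1))) (s / (s - 1)) (by rw [← h0]; module)
    exact div_ne_zero hs0 hs1' this.2
  obtain ⟨z, hz⟩ := exists_one_sub h1
  obtain ⟨w, hw⟩ := exists_one_sub h2
  obtain ⟨c, hc⟩ := h.map_one_sub _ z h1 hz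
  obtain ⟨d, hd⟩ := h.map_one_sub _ w h2 hw
  have h3 : x * z = -(u * w) := Units.ext (by
    push_cast at hz hw ⊢
    rw [hz, hw]
    field_simp
    rw [hu, hv]
    ring)
  have h4 := congrArg (fun t => φ (ofMul t)) h3
  simp only [h.map_ofMul_neg, ofMul_mul, map_add, hc, hd, ofMul_div, map_sub, hu', hv'] at h4
  obtain ⟨h5, h6⟩ := hxy (1 - c - r / (r - 1) + d * (r / (r - 1))) (c - d * (s / (s - 1))) (by
    rw [← sub_eq_zero] at h4
    rw [← h4]
    module)
  have h7 : c * (s - r) = s := by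
    field_simp at h5 h6
    linear_combination s * h5 + r * h6
  have hrs : r ≠ s := fun h8 => hs0 (by rw [← h7, h8, sub_self, mul_zero])
  refine ⟨fun h0 => h1 ?_, div_ne_zero hr0 hs0, fun h8 => hrs ((div_eq_one_iff_eq hs0).1 h8),
    -(x / y * z), ?_, ?_⟩
  · rw [← inv_div, ofMul_inv, map_neg, h0, neg_zero]
  · push_cast at hz ⊢
    rw [hz]
    field_simp
    ring
  · rw [h.map_ofMul_neg, ofMul_mul, map_add, hc, ofMul_div, ofMul_div, map_sub, map_sub]
    have h9 : (r / s - 1) * (1 - c) = r / s := by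
      field_simp
      linear_combination h7
    have h10 : (φ (ofMul x) - φ (ofMul y) + c • (φ (ofMul y) - φ (ofMul x))) =
      (1 - c) • (φ (ofMul x) - φ (ofMul y)) := by module
    rw [h10, smul_smul, h9]

/-- Otherwise x / y would have the excluded parameter 1. -/
theorem IsProper.ne (h : IsCollinearMap k φ) {x y : Kˣ} {r s : k} (hx : IsProper φ x r)
    (hy : IsProper φ y s) (hxy : LinearIndependent k ![φ (ofMul x), φ (ofMul y)]) : r ≠ s :=
  fun hrs => (hx.div h hy hxy).2.2.1 (by rw [hrs, div_self hy.2.1])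

theorem IsProper.mul (h : IsCollinearMap k φ) {x y : Kˣ} {r s : k} (hx : IsProper φ x r)
    (hy : IsProper φ y s) (hxy : LinearIndependent k ![φ (ofMul x), φ (ofMul y)]) :
    IsProper φ (x * y) (r * s) := by
  have h1 := hx.div h (hy.inv h) (by
    rw [LinearIndependent.pair_iff] at hxy ⊢
    intro a b hab
    have h2 := hxy a (-b) (by rw [← hab, ofMul_inv, map_neg]; module)
    simpa using h2)
  rwa [div_inv_eq_mul, div_inv_eq_mul] at h1

theorem IsProper.mul_pow (h : IsCollinearMap k φ) {x y : Kˣ} {r s : k} (hx : IsProper φ x r)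
    (hy : IsProper φ y s) (hxy : LinearIndependent k ![φ (ofMul x), φ (ofMul y)]) (n : ℕ) :
    IsProper φ (x * y ^ n) (r * s ^ n) := by
  induction n with
  | zero => simpa using hx
  | succ n ih =>
    rw [pow_succ, ← mul_assoc, pow_succ, ← mul_assoc]
    refine ih.mul h hy ?_
    rw [LinearIndependent.pair_iff] at hxy ⊢
    intro a b hab
    rw [ofMul_mul, ofMul_pow, map_add, map_nsmul, ← Nat.cast_smul_eq_nsmul k] at hab
    obtain ⟨h1, h2⟩ := hxy a (a * n + b) (by rw [← hab]; module)
    subst h1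
    simpa using h2

theorem IsProper.mul_zpow (h : IsCollinearMap k φ) {x y : Kˣ} {r s : k} (hx : IsProper φ x r)
    (hy : IsProper φ y s) (hxy : LinearIndependent k ![φ (ofMul x), φ (ofMul y)]) (n : ℤ) :
    IsProper φ (x * y ^ n) (r * s ^ n) := by
  obtain ⟨n, rfl | rfl⟩ := n.eq_nat_or_neg
  · simpa using hx.mul_pow h hy hxy n
  · have h1 := hx.mul_pow h (hy.inv h) (by
      rw [LinearIndependent.pair_iff] at hxy ⊢
      intro a b hab
      have h2 := hxy a (-b) (by rw [← hab, ofMul_inv, map_neg]; module)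
      simpa using h2) n
    simpa using h1

/-- Products are controlled only for independent images, so powers of x alone need a detour: x ^ i
is (y x ^ i) / y, and for j ≠ 0 the factor x ^ (i - 1) is attached to x y ^ j. Characteristic zero
keeps these pairs independent. -/
theorem IsProper.zpow_mul_zpow [CharZero k] (h : IsCollinearMap k φ) {x y : Kˣ} {r s : k}
    (hx : IsProper φ x r) (hy : IsProper φ y s)
    (hxy : LinearIndependent k ![φ (ofMul x), φ (ofMul y)]) {i j : ℤ} (hij : i ≠ 0 ∨ j ≠ 0) :
    IsProper φ (x ^ i * y ^ j) (r ^ i * s ^ j) := by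
  have hyx : LinearIndependent k ![φ (ofMul y), φ (ofMul x)] := by
    rw [LinearIndependent.pair_iff] at hxy ⊢
    intro a b hab
    exact (hxy b a (by rw [← hab, add_comm])).symm
  by_cases hj : j = 0
  · subst hj
    have hi : (i : k) ≠ 0 := by simpa using hij
    have h1 := (hy.mul_zpow h hx hyx i).div h hy (by
      rw [LinearIndependent.pair_iff] at hxy ⊢
      intro a b hab
      rw [ofMul_mul, ofMul_zpow, map_add, map_zsmul, ← Int.cast_smul_eq_zsmul k] at hab
      obtain ⟨h1, h2⟩ := hxy (a * i) (a + b) (by rw [← hab]; module)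
      have ha : a = 0 := (mul_eq_zero.1 h1).resolve_right hi
      subst ha
      simpa using h2)
    rw [mul_div_cancel_left, mul_div_cancel_left₀ _ hy.2.1] at h1
    simpa using h1
  · have hj' : (j : k) ≠ 0 := by simpa using hj
    have h1 := (hx.mul_zpow h hy hxy j).mul_zpow h hx (by
      rw [LinearIndependent.pair_iff] at hxy ⊢
      intro a b hab
      rw [ofMul_mul, ofMul_zpow, map_add, map_zsmul, ← Int.cast_smul_eq_zsmul k] at hab
      obtain ⟨h1, h2⟩ := hxy (a + b) (a * j) (by rw [← hab]; module)
      have ha : a = 0 := (mul_eq_zero.1 h2).resolve_right hj'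
      subst ha
      simpa using h1) (i - 1)
    rw [zpow_sub_one, zpow_sub_one₀ hx.2.1] at h1
    convert h1 using 1
    · rw [mul_comm x, mul_assoc, mul_comm x, mul_assoc, inv_mul_cancel, mul_one, mul_comm]
    · field_simp [hx.2.1]

/-- If a subspace contains the images of all proper elements, then it comes from a valuation. -/
theorem exists_valuationSubring (h : IsCollinearMap k φ) (L : Submodule k V)
    (hL : ∀ x (r : k), IsProper φ x r → φ (ofMul x) ∈ L) (h2 : (2 : k) ≠ 0) :
    ∃ v : ValuationSubring K, (∀ x ∈ v.unitGroup, φ (ofMul x) ∈ L) ∧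
      ∀ x ∈ v.principalUnitGroup, φ (ofMul x) = 0 := by
  let π : Kˣ →* Multiplicative V :=
    { toFun := fun x => Multiplicative.ofAdd (φ (ofMul x))
      map_one' := by simp
      map_mul' := fun x y => by simp }
  let H : Subgroup Kˣ := (AddSubgroup.toSubgroup L.toAddSubgroup).comap π
  have hH : ∀ x, x ∈ H ↔ φ (ofMul x) ∈ L := fun x => Iff.rfl
  have hker : ∀ x, π x = 1 ↔ φ (ofMul x) = 0 := fun x => Iff.rfl
  have hrp : RigidPair π H := by
    refine ⟨fun x hx => ?_, h.map_neg_one, fun x y hx hy => ?_⟩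
    · rw [hH, (hker x).1 hx]
      exact L.zero_mem
    · rw [hH] at hx
      have hx0 : φ (ofMul x) ≠ 0 := fun h0 => hx (h0 ▸ L.zero_mem)
      rcases h.map_one_sub_eq_or hx0 hy with h3 | h3 | ⟨r, h3⟩
      · exact Or.inl h3
      · exact Or.inr h3
      · exact absurd (hL x r h3) hx
  -- Kˣ/H embeds into the vector space V/L, in which 2 is invertible.
  obtain ⟨v, hv, hv'⟩ := hrp.exists_valuationSubring (hrp.isRegular_of_sq_mem fun x hx => by
    rw [hH, ofMul_pow, map_nsmul, ← Nat.cast_smul_eq_nsmul k] at hx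
    exact (L.smul_mem_iff (by simpa using h2)).1 hx)
  exact ⟨v, fun x hx => hv hx, fun x hx => hv' hx⟩

/-- If the images of any two proper elements are linearly dependent, then there is a valuation
whose units map into a subspace generated by the image of one element. -/
theorem exists_valuationSubring_span_singleton (h : IsCollinearMap k φ)
    (hdep : ∀ (x y : Kˣ) (r s : k), IsProper φ x r → IsProper φ y s →
      ¬ LinearIndependent k ![φ (ofMul x), φ (ofMul y)]) (h2 : (2 : k) ≠ 0) :
    ∃ (e : Kˣ) (v : ValuationSubring K),
      (∀ x ∈ v.unitGroup, φ (ofMul x) ∈ Submodule.span k {φ (ofMul e)}) ∧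
      ∀ x ∈ v.principalUnitGroup, φ (ofMul x) = 0 := by
  by_cases hex : ∃ (e : Kˣ) (r : k), IsProper φ e r
  · obtain ⟨e, r, he⟩ := hex
    refine ⟨e, h.exists_valuationSubring _ (fun x s hx => ?_) h2⟩
    have h3 := hdep e x r s he hx
    rw [LinearIndependent.pair_iff' he.1] at h3
    push Not at h3
    exact Submodule.mem_span_singleton.2 h3
  · push Not at hex
    exact ⟨1, h.exists_valuationSubring _ (fun x s hx => absurd hx (hex x s)) h2⟩

end IsCollinearMap

/-! ### Lattices over the `p`-adic integers -/

namespace PadicInt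

variable {p : ℕ} [Fact p.Prime] {A : Type*} [AddCommGroup A] [Module ℤ_[p] A]
  [Module.IsTorsionFree ℤ_[p] A]

theorem prime_pow_smul_cancel {n : ℕ} {a b : A} (h : (p : ℤ_[p]) ^ n • a = (p : ℤ_[p]) ^ n • b) :
    a = b :=
  smul_right_injective A (pow_ne_zero n (Nat.cast_ne_zero.2 (Fact.out : p.Prime).ne_zero)) h

/-- Common powers of `p` can be divided out of a combination with small coefficients. -/
theorem exists_primitive_combination {X Y : A} {m : ℕ} (r : ℕ) {d e : ℤ} (hde : d ≠ 0 ∨ e ≠ 0)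
    (hd : |d| < p ^ r) (he : |e| < p ^ r) {w : A}
    (h : d • X + e • Y = (p : ℤ_[p]) ^ (m + r) • w) :
    ∃ (d e : ℤ) (w : A), ¬ ((p : ℤ) ∣ d ∧ (p : ℤ) ∣ e) ∧
      d • X + e • Y = (p : ℤ_[p]) ^ m • w := by
  induction r generalizing d e with
  | zero =>
    -- Each division by p lowers the bound and the power on the right by one. The bound p ^ 0 would
    -- force d = e = 0, so at least p ^ m survives.
    have hd' : d = 0 := by simpa using hd
    have he' : e = 0 := by simpa using he
    simp [hd', he'] at hde
  | succ r ih =>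
    by_cases hdvd : (p : ℤ) ∣ d ∧ (p : ℤ) ∣ e
    · obtain ⟨⟨d, rfl⟩, ⟨e, rfl⟩⟩ := hdvd
      have hp : (0 : ℤ) < p := by exact_mod_cast (Fact.out : p.Prime).pos
      rw [abs_mul, abs_of_pos hp, pow_succ'] at hd he
      refine ih (d := d) (e := e) (hde.imp right_ne_zero_of_mul right_ne_zero_of_mul)
        (lt_of_mul_lt_mul_left hd hp.le) (lt_of_mul_lt_mul_left he hp.le) ?_
      refine prime_pow_smul_cancel (p := p) (n := 1) ?_
      rw [smul_smul, ← pow_add, add_comm 1, add_assoc, ← h, pow_one, mul_smul, mul_smul,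
        ← smul_add, ← Int.cast_smul_eq_zsmul ℤ_[p] (p : ℤ), Int.cast_natCast]
    · exact ⟨d, e, (p : ℤ_[p]) ^ (r + 1) • w, hdvd, by rw [h, smul_smul, pow_add]⟩

theorem pow_dvd_of_norm_sub_lt {x y : ℤ_[p]} {n : ℕ} (h : dist x y < (p : ℝ) ^ (-n : ℤ)) :
    ∃ t, x = y + p ^ n * t := by
  rw [dist_eq_norm] at h
  obtain ⟨t, ht⟩ := Ideal.mem_span_singleton.1 ((norm_le_pow_iff_mem_span_pow _ _).1 h.le)
  exact ⟨t, by rw [← ht]; ring⟩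

/-- Two elements of a separated torsion-free module are dependent if they admit combinations with
small coefficients that are highly divisible. -/
theorem exists_smul_add_smul_eq_zero
    (hsep : ∀ a : A, (∀ n : ℕ, ∃ b, a = (p : ℤ_[p]) ^ n • b) → a = 0) (X Y : A)
    (h : ∀ n : ℕ, n ≠ 0 → ∃ d e : ℤ, (d ≠ 0 ∨ e ≠ 0) ∧ |d| < p ^ n ∧ |e| < p ^ n ∧
      ∃ w, d • X + e • Y = (p : ℤ_[p]) ^ (2 * n) • w) :
    ∃ a b : ℤ_[p], (a ≠ 0 ∨ b ≠ 0) ∧ a • X + b • Y = 0 := by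
  have h1 : ∀ n : ℕ, ∃ (d e : ℤ) (w : A), ¬ ((p : ℤ) ∣ d ∧ (p : ℤ) ∣ e) ∧
      d • X + e • Y = (p : ℤ_[p]) ^ (n + 1) • w := by
    intro n
    obtain ⟨d, e, hde, hd, he, w, hw⟩ := h (n + 1) n.succ_ne_zero
    rw [two_mul] at hw
    exact exists_primitive_combination (n + 1) hde hd he hw
  choose d e w hde hw using h1
  -- A limit of primitive pairs is nonzero modulo p, and a X + b Y is divisible by every power of p,
  -- hence zero.
  obtain ⟨⟨a, b⟩, s, hs, hlim⟩ :=
    CompactSpace.tendsto_subseq fun n => ((d n : ℤ_[p]), (e n : ℤ_[p]))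
  have hp : (0 : ℝ) < p := by exact_mod_cast (Fact.out : p.Prime).pos
  have hclose : ∀ N : ℕ, ∃ n, N ≤ n ∧ (∃ t, (a : ℤ_[p]) = d n + p ^ N * t) ∧
      ∃ t, (b : ℤ_[p]) = e n + p ^ N * t := by
    intro N
    have h2 := (Metric.tendsto_atTop.1 hlim) ((p : ℝ) ^ (-N : ℤ)) (zpow_pos hp _)
    obtain ⟨M, hM⟩ := h2
    have h3 := hM (max M N) (le_max_left _ _)
    rw [dist_comm, Prod.dist_eq, max_lt_iff] at h3
    exact ⟨s (max M N), (le_max_right _ _).trans (hs.id_le _), pow_dvd_of_norm_sub_lt h3.1,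
      pow_dvd_of_norm_sub_lt h3.2⟩
  refine ⟨a, b, ?_, hsep _ fun N => ?_⟩
  · by_contra! hab
    obtain ⟨n, -, ⟨t, ht⟩, ⟨t', ht'⟩⟩ := hclose 1
    have key : ∀ (z : ℤ) (t : ℤ_[p]), (0 : ℤ_[p]) = z + p ^ 1 * t → (p : ℤ) ∣ z := by
      intro z t hz
      have h4 : (z : ℤ_[p]) ∈ Ideal.span {(p : ℤ_[p]) ^ 1} :=
        Ideal.mem_span_singleton.2 ⟨-t, by linear_combination -hz⟩
      rw [← norm_le_pow_iff_mem_span_pow, norm_int_le_pow_iff_dvd] at h4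
      simpa using h4
    exact hde n ⟨key _ t (by rw [← ht, hab.1]), key _ t' (by rw [← ht', hab.2])⟩
  · obtain ⟨n, hn, ⟨t, ht⟩, ⟨t', ht'⟩⟩ := hclose N
    obtain ⟨m, rfl⟩ := Nat.exists_eq_add_of_le hn
    have h5 := hw (N + m)
    rw [← Int.cast_smul_eq_zsmul ℤ_[p], ← Int.cast_smul_eq_zsmul ℤ_[p], add_assoc, pow_add,
      mul_smul] at h5
    refine ⟨(p : ℤ_[p]) ^ (m + 1) • w (N + m) + (t • X + t' • Y), ?_⟩
    rw [smul_add, ← h5, ht, ht']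
    module

/-- Powers of two units of `ℤ_p` with small exponents and a product close to `1`. -/
theorem exists_zpow_mul_zpow_eq (u v : ℤ_[p]ˣ) {n : ℕ} (hn : n ≠ 0) :
    ∃ d e : ℤ, (d ≠ 0 ∨ e ≠ 0) ∧ |d| < p ^ n ∧ |e| < p ^ n ∧
      ∃ t : ℤ_[p], ((u ^ d * v ^ e : ℤ_[p]ˣ) : ℤ_[p]) - 1 = p ^ (2 * n) * t := by
  have hp := (Fact.out : p.Prime)
  have : NeZero (p ^ (2 * n)) := ⟨pow_ne_zero _ hp.ne_zero⟩
  let f : ℤ_[p]ˣ →* (ZMod (p ^ (2 * n)))ˣ := Units.map (toZModPow (p := p) (2 * n)).toMonoidHom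
  -- There are p ^ (2 n) pairs of exponents below p ^ n, but fewer units modulo p ^ (2 n).
  obtain ⟨⟨i, j⟩, ⟨i', j'⟩, hne, heq⟩ := Fintype.exists_ne_map_eq_of_card_lt
    (fun ij : Fin (p ^ n) × Fin (p ^ n) => f u ^ (ij.1 : ℤ) * f v ^ (ij.2 : ℤ)) (by
      rw [ZMod.card_units_eq_totient, Fintype.card_prod, Fintype.card_fin, ← pow_add, ← two_mul]
      exact Nat.totient_lt _ (Nat.one_lt_pow (by positivity) hp.one_lt))
  have habs : ∀ i j : Fin (p ^ n), |((i : ℕ) : ℤ) - (j : ℕ)| < p ^ n := by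
    intro i j
    have hi : ((i : ℕ) : ℤ) < (p : ℤ) ^ n := by exact_mod_cast i.2
    have hj : ((j : ℕ) : ℤ) < (p : ℤ) ^ n := by exact_mod_cast j.2
    rw [abs_lt]
    constructor <;> omega
  refine ⟨(i : ℕ) - (i' : ℕ), (j : ℕ) - (j' : ℕ), ?_, habs _ _, habs _ _, ?_⟩
  · by_contra! h0
    exact hne (Prod.ext (Fin.ext (by have := h0.1; simp only at this ⊢; omega))
      (Fin.ext (by have := h0.2; simp only at this ⊢; omega)))
  · have h1 : f (u ^ ((i : ℕ) - (i' : ℕ) : ℤ) * v ^ ((j : ℕ) - (j' : ℕ) : ℤ)) = 1 := by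
      rw [map_mul, map_zpow, map_zpow, zpow_sub, zpow_sub, mul_mul_mul_comm, heq, ← _root_.mul_inv]
      exact mul_inv_cancel _
    have h2 : toZModPow (2 * n)
        ((u ^ ((i : ℕ) - (i' : ℕ) : ℤ) * v ^ ((j : ℕ) - (j' : ℕ) : ℤ) : ℤ_[p]ˣ) : ℤ_[p]) = 1 :=
      congrArg Units.val h1
    rw [← sub_eq_zero, ← map_one (toZModPow (2 * n)), ← map_sub, ← RingHom.mem_ker,
      ker_toZModPow, Ideal.mem_span_singleton] at h2
    exact h2

end PadicInt

/-! ### Dependence of proper elements over the `p`-adic integers -/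

namespace IsCollinearMap

open Additive

variable {K : Type*} [Field K] {p : ℕ} [Fact p.Prime] {A : Type*} [AddCommGroup A]
  [Module ℤ_[p] A] [Module.IsTorsionFree ℤ_[p] A] {k : Type*} [Field k] [Algebra ℤ_[p] k]
  [IsFractionRing ℤ_[p] k] {V : Type*} [AddCommGroup V] [Module k V]

/-- A proper element can be changed so that its parameter becomes a unit. -/
theorem IsProper.exists_unit {φ : Additive Kˣ →+ V} (h : IsCollinearMap k φ) {x : Kˣ} {r : k}
    (hx : IsProper φ x r) : ∃ (y : Kˣ) (u : ℤ_[p]ˣ) (c : k), c ≠ 0 ∧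
      φ (ofMul y) = c • φ (ofMul x) ∧ IsProper φ y (algebraMap ℤ_[p] k u) := by
  have key : ∀ (x : Kˣ) (r : k), IsProper φ x r → IsLocalization.IsInteger ℤ_[p] r →
      ∃ (y : Kˣ) (u : ℤ_[p]ˣ) (c : k), c ≠ 0 ∧
      φ (ofMul y) = c • φ (ofMul x) ∧ IsProper φ y (algebraMap ℤ_[p] k u) := by
    rintro x _ hx ⟨a, rfl⟩
    -- If a is not a unit then 1 - a is, and it is the parameter of 1 - x, whose image is a nonzero
    -- multiple of that of x.
    rcases IsLocalRing.isUnit_or_isUnit_one_sub_self a with ⟨u, rfl⟩ | ⟨u, hu⟩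
    · exact ⟨x, u, 1, one_ne_zero, (one_smul _ _).symm, hx⟩
    · obtain ⟨hx0, hr0, hr1, y, hy, hr⟩ := id hx
      have hr1' := sub_ne_zero.2 hr1
      refine ⟨y, u, _, div_ne_zero hr0 hr1', ?_, ?_⟩
      · rw [div_eq_inv_mul, mul_smul, ← hr, smul_smul, inv_mul_cancel₀ hr1', one_smul]
      · rw [hu, map_sub, map_one]
        exact hx.one_sub hy
  rcases ValuationRing.isInteger_or_isInteger ℤ_[p] r with hr | hr
  · exact key x r hx hr
  · obtain ⟨y, u, c, hc, hy, hu⟩ := key _ _ (hx.inv h) hr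
    exact ⟨y, u, -c, neg_ne_zero.2 hc, by rw [hy, ofMul_inv, map_neg]; module, hu⟩

/-- Over the `p`-adic integers, proper elements have dependent images. -/
theorem not_linearIndependent_of_isProper [Module ℤ_[p] V] [IsScalarTower ℤ_[p] k V]
    (hsep : ∀ a : A, (∀ n : ℕ, ∃ b, a = (p : ℤ_[p]) ^ n • b) → a = 0)
    (ψ : Additive Kˣ →+ A) (ι : A →ₗ[ℤ_[p]] V) (hι : Function.Injective ι)
    (h : IsCollinearMap k (ι.toAddMonoidHom.comp ψ)) {x y : Kˣ} {r s : k}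
    (hx : IsProper (ι.toAddMonoidHom.comp ψ) x r) (hy : IsProper (ι.toAddMonoidHom.comp ψ) y s) :
    ¬ LinearIndependent k
      ![(ι.toAddMonoidHom.comp ψ) (ofMul x), (ι.toAddMonoidHom.comp ψ) (ofMul y)] := by
  have : CharZero k := charZero_of_injective_algebraMap (IsFractionRing.injective ℤ_[p] k)
  intro hli
  obtain ⟨x', u, c, hc, hx', hu⟩ := hx.exists_unit (p := p) h
  obtain ⟨y', v, d, hd, hy', hv⟩ := hy.exists_unit (p := p) h
  have hli' : LinearIndependent k
      ![(ι.toAddMonoidHom.comp ψ) (ofMul x'), (ι.toAddMonoidHom.comp ψ) (ofMul y')] := by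
    rw [LinearIndependent.pair_iff] at hli ⊢
    intro a b hab
    rw [hx', hy', smul_smul, smul_smul] at hab
    have h1 := hli _ _ hab
    simpa [hc, hd] using h1
  obtain ⟨a, b, hab, h0⟩ := PadicInt.exists_smul_add_smul_eq_zero hsep (ψ (ofMul x'))
    (ψ (ofMul y')) (fun n hn => by
      obtain ⟨d, e, hde, hd, he, t, ht⟩ := PadicInt.exists_zpow_mul_zpow_eq u v hn
      refine ⟨d, e, hde, hd, he, ?_⟩
      -- x' ^ d y' ^ e has parameter g = u ^ d v ^ e, so g times its image is (g - 1) ψ w. Since g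
      -- is a unit and g - 1 is divisible by p ^ (2 n), so is d ψ x' + e ψ y'.
      obtain ⟨-, -, -, w, -, hw⟩ := hu.zpow_mul_zpow h hv hli' hde
      set g := u ^ d * v ^ e with hg
      have h1 : algebraMap ℤ_[p] k u ^ d * algebraMap ℤ_[p] k v ^ e = algebraMap ℤ_[p] k g := by
        have h2 : ∀ u : ℤ_[p]ˣ, algebraMap ℤ_[p] k u =
          (Units.map (algebraMap ℤ_[p] k : ℤ_[p] →* k) u : kˣ) := fun _ => rfl
        rw [h2, h2, h2, hg, map_mul, map_zpow, map_zpow, Units.val_mul,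
          Units.val_zpow_eq_zpow_val, Units.val_zpow_eq_zpow_val]
      have h3 : ((g : ℤ_[p]) - 1) • ψ (ofMul w) = (g : ℤ_[p]) • ψ (ofMul (x' ^ d * y' ^ e)) := by
        refine hι ?_
        rw [h1, ← map_one (algebraMap ℤ_[p] k), ← map_sub, algebraMap_smul, algebraMap_smul] at hw
        rw [map_smul, map_smul]
        exact hw
      refine ⟨((g⁻¹ : ℤ_[p]ˣ) : ℤ_[p]) • t • ψ (ofMul w), ?_⟩
      have h4 : ψ (ofMul (x' ^ d * y' ^ e)) = d • ψ (ofMul x') + e • ψ (ofMul y') := by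
        rw [ofMul_mul, ofMul_zpow, ofMul_zpow, map_add, map_zsmul, map_zsmul]
      rw [← h4, smul_comm, ← mul_smul (_ ^ _), ← ht, h3, smul_smul, Units.inv_mul, one_smul])
  rw [LinearIndependent.pair_iff] at hli'
  have h2 := hli' (algebraMap ℤ_[p] k a) (algebraMap ℤ_[p] k b) (by
    rw [algebraMap_smul, algebraMap_smul]
    have h2 := congrArg ι h0
    rwa [map_add, map_smul, map_smul, map_zero] at h2)
  simp only [FaithfulSMul.algebraMap_eq_zero_iff] at h2
  exact hab.elim (fun h => h h2.1) (fun h => h h2.2)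

end IsCollinearMap

/-! ### Rigidity of subgroups that come from valuations -/

/-- The position of `x` and `1 - x` relative to a valuation. -/
theorem ValuationSubring.mem_or_div_mem_or_of_one_sub {K : Type*} [Field K] (v : ValuationSubring K)
    {T H : Subgroup Kˣ} (hT : (-1 : Kˣ) ∈ T) (hH : v.unitGroup ≤ H)
    (hvT : v.principalUnitGroup ≤ T) {x y : Kˣ} (hx : x ∉ T) (hy : (y : K) = 1 - x) :
    y ∈ T ∨ y / x ∈ T ∨ (x ∈ H ∧ y ∈ H) := by
  have hx' : (x : K) = 1 - y := by rw [hy]; ring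
  have hyx : ((-(y / x) : Kˣ) : K) = 1 - ((x⁻¹ : Kˣ) : K) := by
    push_cast
    rw [hy]
    field_simp
    ring
  have hneg : ∀ z, -z ∈ T ↔ z ∈ T := fun z => by
    rw [← neg_one_mul]
    exact T.mul_mem_cancel_left hT
  by_cases h1 : (x : K) ∈ v
  · by_cases h2 : ((x⁻¹ : Kˣ) : K) ∈ v
    · by_cases h3 : ((y⁻¹ : Kˣ) : K) ∈ v
      · refine Or.inr (Or.inr ⟨hH ((v.mem_unitGroup_iff_mem x).2 ⟨h1, h2⟩),
          hH ((v.mem_unitGroup_iff_mem y).2 ⟨?_, h3⟩)⟩)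
        rw [hy]
        exact v.sub_mem v.one_mem h1
      · exact absurd (hvT ((v.mem_principalUnitGroup_iff_inv_notMem x y hy).2 h3)) hx
    · exact Or.inl (hvT ((v.mem_principalUnitGroup_iff_inv_notMem y x hx').2 h2))
  · refine Or.inr (Or.inl ((hneg _).1 (hvT
      ((v.mem_principalUnitGroup_iff_inv_notMem _ x⁻¹ ?_).2 (by simpa using h1)))))
    rw [hyx]
    ring

theorem IsRigid.of_valuationSubring {K : Type*} [Field K] {T H : Subgroup Kˣ}
    (hT : (-1 : Kˣ) ∈ T) (hc : IsCyclic (H.map (QuotientGroup.mk' T))) (v : ValuationSubring K)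
    (hH : v.unitGroup ≤ H) (hvT : v.principalUnitGroup ≤ T) : IsRigid T := by
  intro x y hx hy
  have hmem : ∀ S : Subgroup (Kˣ ⧸ T), IsCyclic S → QuotientGroup.mk' T x ∈ S →
      QuotientGroup.mk' T y ∈ S →
      IsCyclic ((Subgroup.closure {x, y}).map (QuotientGroup.mk' T)) := by
    intro S hS h1 h2
    refine Subgroup.isCyclic_of_le (H' := S) ?_
    rw [Subgroup.map_le_iff_le_comap, Subgroup.closure_le]
    rintro z (rfl | rfl)
    · exact h1
    · exact h2
  rcases v.mem_or_div_mem_or_of_one_sub hT hH hvT hx hy with h | h | ⟨h, h'⟩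
  · refine hmem _ (Subgroup.isCyclic_zpowers (QuotientGroup.mk' T x)) (Subgroup.mem_zpowers _) ?_
    rw [(QuotientGroup.eq_one_iff y).2 h |> (show QuotientGroup.mk' T y = 1 from ·)]
    exact Subgroup.one_mem _
  · refine hmem _ (Subgroup.isCyclic_zpowers (QuotientGroup.mk' T x)) (Subgroup.mem_zpowers _) ?_
    have h1 : QuotientGroup.mk' T (y / x) = 1 := (QuotientGroup.eq_one_iff _).2 h
    rw [map_div, div_eq_one] at h1
    rw [h1]
    exact Subgroup.mem_zpowers _
  · exact hmem _ hc ⟨x, h, rfl⟩ ⟨y, h', rfl⟩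

/-- A submodule of a principal submodule over a principal ideal domain is principal. -/
theorem Submodule.IsPrincipal.of_le {R M : Type*} [CommRing R] [IsPrincipalIdealRing R]
    [AddCommGroup M] [Module R M] {N P : Submodule R M} (hP : P.IsPrincipal) (h : N ≤ P) :
    N.IsPrincipal := by
  obtain ⟨g, rfl⟩ := hP
  have h1 : N = (N.comap (LinearMap.toSpanSingleton R M g)).map
      (LinearMap.toSpanSingleton R M g) := by
    rw [Submodule.map_comap_eq, LinearMap.range_toSpanSingleton, inf_eq_right.2 h]
  rw [h1]
  exact Submodule.IsPrincipal.map _ (IsPrincipalIdealRing.principal _)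

namespace UnitsCompletion

open Additive

variable {K : Type*} [Field K] {ℓ : ℕ} [Fact ℓ.Prime]
  {T : Submodule ℤ_[ℓ] (UnitsCompletion K ℓ)}

/-- The map from `Kˣ` to the quotient of its completion. -/
noncomputable def toQuotient (T : Submodule ℤ_[ℓ] (UnitsCompletion K ℓ)) :
    Additive Kˣ →+ UnitsCompletion K ℓ ⧸ T :=
  T.mkQ.toAddMonoidHom.comp (of K ℓ)

theorem mem_trace_iff (x : Kˣ) : x ∈ trace T ↔ toQuotient T (ofMul x) = 0 :=
  (Submodule.Quotient.mk_eq_zero T).symm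

/-- Torsion-freeness replaces the assumption -1 ∈ T of part (a). -/
theorem toQuotient_neg_one [Module.IsTorsionFree ℤ_[ℓ] (UnitsCompletion K ℓ ⧸ T)] :
    toQuotient T (ofMul (-1)) = 0 := by
  have h1 : (2 : ℤ_[ℓ]) • toQuotient T (ofMul (-1)) = 0 := by
    rw [two_smul, ← map_add, ← ofMul_mul]
    simp
  exact (smul_eq_zero.1 h1).resolve_left two_ne_zero

theorem IsRigid.of_valuationSubring [Module.IsTorsionFree ℤ_[ℓ] (UnitsCompletion K ℓ ⧸ T)]
    {H : Submodule ℤ_[ℓ] (UnitsCompletion K ℓ)} (hc : (H.map T.mkQ).IsPrincipal)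
    (v : ValuationSubring K) (hH : v.unitGroup ≤ trace H) (hvT : v.principalUnitGroup ≤ trace T) :
    IsRigid T := by
  intro x y hx hy
  have hmem : ∀ S : Submodule ℤ_[ℓ] (UnitsCompletion K ℓ ⧸ T), S.IsPrincipal →
      toQuotient T (ofMul x) ∈ S → toQuotient T (ofMul y) ∈ S →
      ((Submodule.span ℤ_[ℓ] {of K ℓ (ofMul x), of K ℓ (ofMul y)}).map T.mkQ).IsPrincipal := by
    intro S hS h1 h2
    refine hS.of_le ?_
    rw [Submodule.map_le_iff_le_comap, Submodule.span_le]
    rintro z (rfl | rfl)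
    · exact h1
    · exact h2
  rcases v.mem_or_div_mem_or_of_one_sub ((mem_trace_iff _).2 toQuotient_neg_one) hH hvT hx hy with
    h | h | ⟨h, h'⟩
  · refine hmem _ ⟨_, rfl⟩ (Submodule.mem_span_singleton_self _) ?_
    rw [(mem_trace_iff y).1 h]
    exact Submodule.zero_mem _
  · refine hmem _ ⟨_, rfl⟩ (Submodule.mem_span_singleton_self _) ?_
    rw [mem_trace_iff, ofMul_div, map_sub, sub_eq_zero] at h
    rw [h]
    exact Submodule.mem_span_singleton_self _
  · exact hmem _ hc ⟨_, h, rfl⟩ ⟨_, h', rfl⟩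

/-! ### The topology of the completion -/

/-- The quotient by a closed submodule is `ℓ`-adically separated. -/
theorem eq_zero_of_forall_exists_eq_smul (hT : IsClosed (T : Set (UnitsCompletion K ℓ)))
    (a : UnitsCompletion K ℓ ⧸ T) (ha : ∀ n : ℕ, ∃ b, a = (ℓ : ℤ_[ℓ]) ^ n • b) : a = 0 := by
  obtain ⟨h, rfl⟩ := T.mkQ_surjective a
  have h1 : ∀ n : ℕ, ∃ b : UnitsCompletion K ℓ, h - (ℓ : ℤ_[ℓ]) ^ n • b ∈ T := by
    intro n
    obtain ⟨b, hb⟩ := ha n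
    obtain ⟨b, rfl⟩ := T.mkQ_surjective b
    exact ⟨b, (Submodule.Quotient.eq T).1 hb⟩
  choose b hb using h1
  refine (Submodule.Quotient.mk_eq_zero T).2 ?_
  -- The component at level m is killed by ℓ ^ m, so the corrections ℓ ^ n b_n tend to 0 and h is a
  -- limit of elements of T.
  have hlim : Filter.Tendsto (fun n => h - (ℓ : ℤ_[ℓ]) ^ n • b n) Filter.atTop (nhds h) := by
    rw [tendsto_subtype_rng, tendsto_pi_nhds]
    intro m
    refine tendsto_nhds_of_eventually_eq ?_
    filter_upwards [Filter.eventually_ge_atTop m] with n hn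
    obtain ⟨j, rfl⟩ := Nat.exists_eq_add_of_le hn
    have h2 : (((ℓ : ℤ_[ℓ]) ^ (m + j) • b (m + j) : UnitsCompletion K ℓ) :
        ∀ n, UnitsModPow K ℓ n) m = 0 := by
      have h3 : ((ℓ : ℤ_[ℓ]) ^ (m + j) • b (m + j) : UnitsCompletion K ℓ) =
          ℓ ^ m • ((ℓ : ℤ_[ℓ]) ^ j • b (m + j)) := by
        rw [pow_add, mul_smul, ← Nat.cast_smul_eq_nsmul ℤ_[ℓ], Nat.cast_pow]
      rw [h3]
      exact UnitsModPow.pow_nsmul_eq_zero K ℓ m _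
    change (h : ∀ n, UnitsModPow K ℓ n) m - _ = _
    rw [h2, sub_zero]
  have h4 := mem_closure_of_tendsto hlim (Filter.Eventually.of_forall hb)
  rwa [hT.closure_eq] at h4

theorem continuous_smul_const (h : UnitsCompletion K ℓ) : Continuous fun z : ℤ_[ℓ] => z • h := by
  refine Continuous.subtype_mk (continuous_pi fun n => ?_) _
  refine IsLocallyConstant.continuous ((IsLocallyConstant.iff_eventually_eq _).2 fun z => ?_)
  have hp : (0 : ℝ) < ℓ := by exact_mod_cast (Fact.out : ℓ.Prime).pos
  filter_upwards [Metric.ball_mem_nhds z (zpow_pos hp (-n : ℤ))] with y hy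
  obtain ⟨t, rfl⟩ := PadicInt.pow_dvd_of_norm_sub_lt hy
  change (z + (ℓ : ℤ_[ℓ]) ^ n * t) • (h : ∀ n, UnitsModPow K ℓ n) n = _
  rw [add_smul, mul_smul, ← Nat.cast_pow, Nat.cast_smul_eq_nsmul,
    UnitsModPow.pow_nsmul_eq_zero, add_zero]
  rfl

open scoped Pointwise in
/-- The inverse image of a principal submodule of the quotient by a closed submodule is closed. -/
theorem isClosed_comap_mkQ (hT : IsClosed (T : Set (UnitsCompletion K ℓ)))
    {N : Submodule ℤ_[ℓ] (UnitsCompletion K ℓ ⧸ T)} (hN : N.IsPrincipal) :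
    IsClosed (N.comap T.mkQ : Set (UnitsCompletion K ℓ)) := by
  obtain ⟨g, rfl⟩ := hN
  obtain ⟨h, rfl⟩ := T.mkQ_surjective g
  -- The preimage is T + ℤ_ℓ h, a closed set plus a compact one.
  have h1 : ((Submodule.span ℤ_[ℓ] {T.mkQ h}).comap T.mkQ : Set (UnitsCompletion K ℓ)) =
      (T : Set (UnitsCompletion K ℓ)) + Set.range fun z : ℤ_[ℓ] => z • h := by
    ext a
    simp only [SetLike.mem_coe, Submodule.mem_comap, Submodule.mem_span_singleton, Set.mem_add,
      Set.mem_range]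
    constructor
    · rintro ⟨z, hz⟩
      refine ⟨a - z • h, ?_, z • h, ⟨z, rfl⟩, by abel⟩
      rw [← Submodule.Quotient.mk_eq_zero T]
      change T.mkQ (a - z • h) = 0
      rw [map_sub, map_smul, hz, sub_self]
    · rintro ⟨t, ht, _, ⟨z, rfl⟩, rfl⟩
      refine ⟨z, ?_⟩
      rw [map_add, map_smul, Submodule.mkQ_apply T t, (Submodule.Quotient.mk_eq_zero T).2 ht,
        zero_add]
  rw [h1]
  exact hT.add_right_of_isCompact (isCompact_range (continuous_smul_const h))

end UnitsCompletion

/-! ### Saturated submodules of rank one -/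

/-- A saturated submodule of rank at most one of a separated torsion-free module over the
`p`-adic integers is principal. -/
theorem PadicInt.isPrincipal_of_forall_exists_smul_eq {p : ℕ} [Fact p.Prime] {A : Type*}
    [AddCommGroup A] [Module ℤ_[p] A] [Module.IsTorsionFree ℤ_[p] A]
    (hsep : ∀ a : A, (∀ n : ℕ, ∃ b, a = (p : ℤ_[p]) ^ n • b) → a = 0) (N : Submodule ℤ_[p] A)
    (hsat : ∀ (r : ℤ_[p]) (a : A), r ≠ 0 → r • a ∈ N → a ∈ N)
    (hrank : ∀ a ∈ N, ∀ b ∈ N, a ≠ 0 → ∃ r s : ℤ_[p], r ≠ 0 ∧ r • b = s • a) :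
    N.IsPrincipal := by
  have hp0 : (p : ℤ_[p]) ≠ 0 := Nat.cast_ne_zero.2 (Fact.out : p.Prime).ne_zero
  rcases eq_or_ne N ⊥ with rfl | hN
  · exact ⟨0, by simp⟩
  obtain ⟨a, haN, ha0⟩ := N.ne_bot_iff.1 hN
  have hex : ∃ n : ℕ, ¬ ∃ b, a = (p : ℤ_[p]) ^ n • b := by
    by_contra! hcon
    exact ha0 (hsep a hcon)
  classical
  -- p ^ m is the largest power of p dividing a, so a = p ^ m g with g not divisible by p. Such a g
  -- generates N: in a relation c b = g the scalar c must be a unit.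
  obtain ⟨m, hm⟩ : ∃ m, Nat.find hex = m + 1 := Nat.exists_eq_succ_of_ne_zero fun h0 => by
    have h1 := Nat.find_spec hex
    rw [h0] at h1
    exact h1 ⟨a, by simp⟩
  obtain ⟨g, hg⟩ := not_not.1 (Nat.find_min hex (m := m) (by omega))
  have hg1 : ∀ b, g ≠ (p : ℤ_[p]) • b := by
    rintro b rfl
    refine Nat.find_spec hex ⟨b, ?_⟩
    rw [hm, pow_succ, mul_smul, ← hg]
  have hg0 : g ≠ 0 := fun h0 => hg1 0 (by rw [h0, smul_zero])
  have hgN : g ∈ N := hsat _ g (pow_ne_zero m hp0) (hg ▸ haN)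
  refine ⟨g, le_antisymm (fun b hb => ?_) ((Submodule.span_singleton_le_iff_mem _ _).2 hgN)⟩
  obtain ⟨r, s, hr, hrs⟩ := hrank g hgN b hb hg0
  rw [Submodule.mem_span_singleton]
  rcases ValuationRing.dvd_total r s with ⟨c, rfl⟩ | ⟨c, rfl⟩
  · rw [mul_smul] at hrs
    exact ⟨c, (smul_right_injective A hr hrs).symm⟩
  · rw [mul_smul] at hrs
    have h1 : c • b = g := smul_right_injective A (left_ne_zero_of_mul hr) hrs
    by_cases hc : IsUnit c
    · obtain ⟨u, rfl⟩ := hc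
      exact ⟨((u⁻¹ : ℤ_[p]ˣ) : ℤ_[p]), by rw [← h1, smul_smul, Units.inv_mul, one_smul]⟩
    · have h2 := (IsLocalRing.mem_maximalIdeal c).2 hc
      rw [PadicInt.maximalIdeal_eq_span_p, Ideal.mem_span_singleton] at h2
      obtain ⟨t, rfl⟩ := h2
      exact absurd (by rw [← h1, mul_smul]) (hg1 (t • b))

/-! ### Rigid subgroups of exponent `ℓ` -/

namespace IsRigid

open Additive

variable {K : Type*} [Field K] {ℓ : ℕ} [Fact ℓ.Prime] {T : Subgroup Kˣ}

theorem isCollinearMap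
    [@Module (ZMod ℓ) (Additive (Kˣ ⧸ T)) _ AddCommGroup.toAddCommMonoid] (h : IsRigid T)
    (hT : (-1 : Kˣ) ∈ T) : IsCollinearMap (K := K) (ZMod ℓ) (V := Additive (Kˣ ⧸ T))
      (MonoidHom.toAdditive (QuotientGroup.mk' T)) where
  map_neg_one := (QuotientGroup.eq_one_iff (-1 : Kˣ)).2 hT
  map_one_sub x y hx hy := by
    obtain ⟨g, hg⟩ := (Subgroup.isCyclic_iff_exists_zpowers_eq_top _).1
      (h x y (fun hxT => hx ((QuotientGroup.eq_one_iff x).2 hxT)) hy)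
    have hmem : ∀ z, z ∈ ({x, y} : Set Kˣ) → ∃ i : ℤ,
        (i : ZMod ℓ) • ofMul g = MonoidHom.toAdditive (QuotientGroup.mk' T) (ofMul z) := by
      intro z hz
      have h1 : QuotientGroup.mk' T z ∈ Subgroup.zpowers g := by
        rw [hg]
        exact Subgroup.mem_map_of_mem _ (Subgroup.subset_closure hz)
      obtain ⟨i, hi⟩ := Subgroup.mem_zpowers_iff.1 h1
      refine ⟨i, ?_⟩
      rw [Int.cast_smul_eq_zsmul, ← ofMul_zpow, hi]
      rfl
    obtain ⟨i, hi⟩ := hmem x (by simp)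
    obtain ⟨j, hj⟩ := hmem y (by simp)
    have hi0 : (i : ZMod ℓ) ≠ 0 := fun h0 => hx (by rw [← hi, h0, zero_smul])
    exact ⟨j / i, by rw [← hi, ← hj, smul_smul, div_mul_cancel₀ _ hi0]⟩

end IsRigid

/-- Over the field with `ℓ` elements, proper elements have dependent images. -/
theorem IsCollinearMap.not_linearIndependent_of_isProper_zmod {K : Type*} [Field K] {ℓ : ℕ}
    [Fact ℓ.Prime] {V : Type*} [AddCommGroup V] [Module (ZMod ℓ) V] {φ : Additive Kˣ →+ V}
    (h : IsCollinearMap (ZMod ℓ) φ) {x y : Kˣ} {r s : ZMod ℓ} (hx : IsProper φ x r)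
    (hy : IsProper φ y s) :
    ¬ LinearIndependent (ZMod ℓ) ![φ (Additive.ofMul x), φ (Additive.ofMul y)] := by
  intro hli
  -- By Fermat x y ^ (ℓ - 1) has the same parameter r as x, yet its image φ x - φ y is independent
  -- of φ x.
  have h1 := hx.mul_pow h hy hli (ℓ - 1)
  rw [ZMod.pow_card_sub_one_eq_one hy.2.1, mul_one] at h1
  refine hx.ne h h1 ?_ rfl
  rw [LinearIndependent.pair_iff] at hli ⊢
  intro a b hab
  rw [ofMul_mul, ofMul_pow, map_add, map_nsmul, ← Nat.cast_smul_eq_nsmul (ZMod ℓ),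
    Nat.cast_pred (Fact.out : ℓ.Prime).pos, CharP.cast_eq_zero, zero_sub] at hab
  obtain ⟨h2, h3⟩ := hli (a + b) (-b) (by rw [← hab]; module)
  rw [neg_eq_zero] at h3
  exact ⟨by rwa [h3, add_zero] at h2, h3⟩

/-- A rigid subgroup containing the `ℓ`-th powers and `-1` comes from a valuation. -/
theorem IsRigid.exists_valuationSubring {K : Type*} [Field K] (ℓ : ℕ) [Fact ℓ.Prime]
    {T : Subgroup Kˣ} (hrig : IsRigid T) (hpow : (powMonoidHom ℓ : Kˣ →* Kˣ).range ≤ T)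
    (hT : (-1 : Kˣ) ∈ T) : ∃ (e : Kˣ) (v : ValuationSubring K),
      v.unitGroup ≤ (Subgroup.zpowers (QuotientGroup.mk' T e)).comap (QuotientGroup.mk' T) ∧
      v.principalUnitGroup ≤ T := by
  have hexp : ∀ g : Kˣ ⧸ T, g ^ ℓ = 1 := by
    intro g
    obtain ⟨x, rfl⟩ := QuotientGroup.mk'_surjective T g
    rw [← map_pow]
    exact (QuotientGroup.eq_one_iff _).2 (hpow ⟨x, rfl⟩)
  let _ : @Module (ZMod ℓ) (Additive (Kˣ ⧸ T)) _ AddCommGroup.toAddCommMonoid :=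
    AddCommGroup.zmodModule hexp
  have hcol := hrig.isCollinearMap (ℓ := ℓ) hT
  rcases eq_or_ne ℓ 2 with rfl | hℓ
  -- Over F_2 no parameter other than 0 and 1 exists, so no element is proper and H can start as the
  -- kernel.
  · have hrp : RigidPair (K := K) (G := Kˣ ⧸ T) (QuotientGroup.mk' T) (QuotientGroup.mk' T).ker :=
      ⟨le_rfl, hcol.map_neg_one, fun x y hx hy => by
        rcases hcol.map_one_sub_eq_or hx hy with h1 | h1 | ⟨r, -, hr0, hr1, -⟩
        · exact Or.inl h1
        · exact Or.inr h1
        · exact absurd (Fin.eq_one_of_ne_zero r hr0) hr1⟩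
    obtain ⟨e, v, hv, hv'⟩ := hrp.exists_comap_zpowers_of_exponent_two fun g => by
      rw [← sq, hexp]
    rw [QuotientGroup.ker_mk'] at hv'
    exact ⟨e, v, hv, hv'⟩
  · have h2 : (2 : ZMod ℓ) ≠ 0 := fun h0 => hℓ
      (((Nat.prime_dvd_prime_iff_eq Fact.out Nat.prime_two).1
        ((ZMod.natCast_eq_zero_iff 2 ℓ).1 (by exact_mod_cast h0))))
    obtain ⟨e, v, hv, hv'⟩ := hcol.exists_valuationSubring_span_singleton
      (fun x y r s hx hy => hcol.not_linearIndependent_of_isProper_zmod hx hy) h2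
    refine ⟨e, v, fun x hx => ?_, fun x hx => (QuotientGroup.eq_one_iff x).1 (hv' x hx)⟩
    obtain ⟨a, ha⟩ := Submodule.mem_span_singleton.1 (hv x hx)
    rw [Subgroup.mem_comap, Subgroup.mem_zpowers_iff]
    refine ⟨a.val, ?_⟩
    rw [zpow_natCast]
    have h3 : (a.val : ZMod ℓ) • MonoidHom.toAdditive (QuotientGroup.mk' T) (Additive.ofMul e) =
        MonoidHom.toAdditive (QuotientGroup.mk' T) (Additive.ofMul x) := by
      rw [ZMod.natCast_zmod_val, ha]
    rw [Nat.cast_smul_eq_nsmul] at h3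
    exact h3

/-! ### Rigid submodules of the completion -/

namespace UnitsCompletion

open Additive

variable {K : Type*} [Field K] {ℓ : ℕ} [Fact ℓ.Prime]
  {T : Submodule ℤ_[ℓ] (UnitsCompletion K ℓ)}

theorem IsRigid.isCollinearMap [Module.IsTorsionFree ℤ_[ℓ] (UnitsCompletion K ℓ ⧸ T)]
    (h : IsRigid T) {k V : Type*} [Field k] [Algebra ℤ_[ℓ] k] [IsFractionRing ℤ_[ℓ] k]
    [AddCommGroup V] [Module k V] [Module ℤ_[ℓ] V] [IsScalarTower ℤ_[ℓ] k V]
    (ι : UnitsCompletion K ℓ ⧸ T →ₗ[ℤ_[ℓ]] V) :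
    IsCollinearMap k (ι.toAddMonoidHom.comp (toQuotient T)) where
  map_neg_one := by
    rw [AddMonoidHom.comp_apply, toQuotient_neg_one, map_zero]
  map_one_sub x y hx hy := by
    obtain ⟨g, hg⟩ := h x y (fun hxT => hx (by
      rw [AddMonoidHom.comp_apply, (mem_trace_iff x).1 hxT, map_zero])) hy
    have hmem : ∀ z, z ∈ ({x, y} : Set Kˣ) → ∃ a : ℤ_[ℓ],
        algebraMap ℤ_[ℓ] k a • ι g = (ι.toAddMonoidHom.comp (toQuotient T)) (ofMul z) := by
      intro z hz
      have h1 : toQuotient T (ofMul z) ∈ Submodule.span ℤ_[ℓ] {g} := by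
        rw [← hg]
        refine Submodule.mem_map_of_mem (Submodule.subset_span ?_)
        rcases hz with rfl | rfl
        · exact Or.inl rfl
        · exact Or.inr rfl
      obtain ⟨a, ha⟩ := Submodule.mem_span_singleton.1 h1
      refine ⟨a, ?_⟩
      rw [algebraMap_smul, ← map_smul, ha]
      rfl
    obtain ⟨a, ha⟩ := hmem x (by simp)
    obtain ⟨b, hb⟩ := hmem y (by simp)
    have ha0 : algebraMap ℤ_[ℓ] k a ≠ 0 := fun h0 => hx (by rw [← ha, h0, zero_smul])
    exact ⟨algebraMap ℤ_[ℓ] k b / algebraMap ℤ_[ℓ] k a, by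
      rw [← ha, ← hb, smul_smul, div_mul_cancel₀ _ ha0]⟩

/-- A closed rigid submodule with torsion-free quotient comes from a valuation. -/
theorem IsRigid.exists_valuationSubring
    [Module.IsTorsionFree ℤ_[ℓ] (UnitsCompletion K ℓ ⧸ T)] (hrig : IsRigid T)
    (hT : IsClosed (T : Set (UnitsCompletion K ℓ))) :
    ∃ (N : Submodule ℤ_[ℓ] (UnitsCompletion K ℓ ⧸ T)) (v : ValuationSubring K),
      N.IsPrincipal ∧ v.unitGroup ≤ trace (N.comap T.mkQ) ∧ v.principalUnitGroup ≤ trace T := by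
  let k := FractionRing ℤ_[ℓ]
  let V := LocalizedModule (nonZeroDivisors ℤ_[ℓ]) (UnitsCompletion K ℓ ⧸ T)
  let ι : UnitsCompletion K ℓ ⧸ T →ₗ[ℤ_[ℓ]] V := LocalizedModule.mkLinearMap _ _
  have hι : Function.Injective ι := fun a b hab => by
    obtain ⟨c, hc⟩ := (IsLocalizedModule.eq_iff_exists (nonZeroDivisors ℤ_[ℓ]) ι).1 hab
    exact smul_right_injective _ (nonZeroDivisors.ne_zero c.2) hc
  have hsep := eq_zero_of_forall_exists_eq_smul hT
  have hcol := hrig.isCollinearMap (k := k) ι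
  have hk : CharZero k := charZero_of_injective_algebraMap (IsFractionRing.injective ℤ_[ℓ] k)
  obtain ⟨e, v, hv, hv'⟩ := hcol.exists_valuationSubring_span_singleton
    (fun x y r s hx hy => IsCollinearMap.not_linearIndependent_of_isProper hsep _ ι hι hcol hx hy)
    two_ne_zero
  let L : Submodule k V := Submodule.span k {ι (toQuotient T (ofMul e))}
  -- The part of the quotient lying on the line L is saturated of rank at most one, so separatedness
  -- makes it principal.
  refine ⟨(L.restrictScalars ℤ_[ℓ]).comap ι, v, ?_, hv, fun x hx => ?_⟩
  · refine PadicInt.isPrincipal_of_forall_exists_smul_eq hsep _ (fun r a hr ha => ?_)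
      (fun a ha b hb ha0 => ?_)
    · rw [Submodule.mem_comap, map_smul, Submodule.restrictScalars_mem,
        ← algebraMap_smul k r] at ha
      exact (L.smul_mem_iff ((FaithfulSMul.algebraMap_eq_zero_iff ℤ_[ℓ] k).not.2 hr)).1 ha
    · obtain ⟨c, hc⟩ := Submodule.mem_span_singleton.1 ha
      obtain ⟨d, hd⟩ := Submodule.mem_span_singleton.1 hb
      have hc0 : c ≠ 0 := by
        rintro rfl
        rw [zero_smul] at hc
        exact ha0 (hι (by rw [← hc, map_zero]))
      obtain ⟨s, r, hr, hsr⟩ := IsFractionRing.div_surjective (A := ℤ_[ℓ]) (d / c)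
      have hr0 := nonZeroDivisors.ne_zero hr
      refine ⟨r, s, hr0, hι ?_⟩
      have hr0' : algebraMap ℤ_[ℓ] k r ≠ 0 :=
        (FaithfulSMul.algebraMap_eq_zero_iff ℤ_[ℓ] k).not.2 hr0
      rw [map_smul, map_smul, ← hc, ← hd, ← algebraMap_smul k r, ← algebraMap_smul k s, smul_smul,
        smul_smul]
      congr 1
      rw [div_eq_div_iff hr0' hc0] at hsr
      rw [hsr, mul_comm]
  · exact (mem_trace_iff x).2 (hι ((hv' x hx).trans (map_zero ι).symm))

end UnitsCompletion

/-! ### The two equivalences -/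

theorem mainTheorem9 {K : Type*} [Field K] (ℓ : ℕ) [Fact ℓ.Prime] :
    (∀ T : Subgroup Kˣ, (powMonoidHom ℓ : Kˣ →* Kˣ).range ≤ T → (-1 : Kˣ) ∈ T →
      ((∃ H : Subgroup Kˣ, T ≤ H ∧ IsCyclic (H.map (QuotientGroup.mk' T)) ∧ IsValuative H ∧
          ∃ v : ValuationSubring K, IsCanonicalValuation H v ∧ v.principalUnitGroup ≤ T) ↔
        IsRigid T)) ∧
    (∀ T : Submodule ℤ_[ℓ] (UnitsCompletion K ℓ),
      IsClosed (T : Set (UnitsCompletion K ℓ)) →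
      Module.IsTorsionFree ℤ_[ℓ] (UnitsCompletion K ℓ ⧸ T) →
      ((∃ H : Submodule ℤ_[ℓ] (UnitsCompletion K ℓ),
          IsClosed (H : Set (UnitsCompletion K ℓ)) ∧ T ≤ H ∧ (H.map T.mkQ).IsPrincipal ∧
          UnitsCompletion.IsValuative H ∧
          ∃ v : ValuationSubring K, UnitsCompletion.IsCanonicalValuation H v ∧
            v.principalUnitGroup ≤ UnitsCompletion.trace T) ↔
        UnitsCompletion.IsRigid T)) := by
  refine ⟨fun T hpow hneg => ⟨?_, fun hrig => ?_⟩, fun T hcl htf => ⟨?_, fun hrig => ?_⟩⟩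
  · rintro ⟨H, -, hc, -, v, hv, hvT⟩
    exact IsRigid.of_valuationSubring hneg hc v hv.1 hvT
  · obtain ⟨e, v, hv, hvT⟩ := hrig.exists_valuationSubring ℓ hpow hneg
    refine ⟨_, fun x hx => ?_, ?_, ⟨v, hv⟩,
      exists_isCanonicalValuation_principalUnitGroup_le hv hvT⟩
    · have h1 : QuotientGroup.mk' T x = 1 := (QuotientGroup.eq_one_iff x).2 hx
      rw [Subgroup.mem_comap, h1]
      exact Subgroup.one_mem _
    · have := Subgroup.isCyclic_zpowers (QuotientGroup.mk' T e)
      exact Subgroup.isCyclic_of_le (Subgroup.map_comap_le _ _)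
  · rintro ⟨H, -, -, hc, -, v, hv, hvT⟩
    exact UnitsCompletion.IsRigid.of_valuationSubring hc v hv.1 hvT
  · obtain ⟨N, v, hN, hv, hvT⟩ := hrig.exists_valuationSubring hcl
    refine ⟨N.comap T.mkQ, UnitsCompletion.isClosed_comap_mkQ hcl hN, fun t ht => ?_, ?_, ⟨v, hv⟩,
      exists_isCanonicalValuation_principalUnitGroup_le hv hvT⟩
    · rw [Submodule.mem_comap, Submodule.mkQ_apply, (Submodule.Quotient.mk_eq_zero T).2 ht]
      exact N.zero_mem
    · rwa [Submodule.map_comap_eq_of_surjective T.mkQ_surjective]
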